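/- Let $K$ be a field, $n\ge 0$, $R=K[x_1,\dots,x_n]$ with the degree reverse lexicographic order $\succ$, $x_1\succ\dots\succ x_n$, and let $2\le d_1\le\dots\le d_n$ be integers. A *term* is a product of powers of the variables. For a homogeneous ideal $I\subseteq R$ write $H_{R/I}(t)=\dim_K (R/I)_t$, and let $I_{\le t}$ be the ideal generated by the homogeneous polynomials of degree $\le t$ in $I$. A monomial ideal $J\subseteq R$ is *almost revlex* if, for every minimal monomial generator $\tau$ of $J$, every term $\tau'$ with $\deg\tau'=\deg\tau$ and $\tau'\succ\tau$ belongs to $J$. For a monomial ideal $J$ let $\mathcal N(J)_t$ be the set of the terms of degree $t$ not in $J$, and let the *first expansion* $\mathcal E(\mathcal N(J)_t)$ be the set of the terms of degree $t+1$ that are not the product of a variable and a term of degree $t$ in $J$. Let $H^{[n]}$ be the Hilbert function of $R/(x_1^{d_1},\dots,x_n^{d_n})$. Define monomial ideals $J^{[i]}\subseteq K[x_1,\dots,x_i]$, $0\le i\le n$, inductively as follows, with $H^{[i]}$ defined as above for $d_1,\dots,d_i$. Put $J^{[0]}=0$. For $i\ge 1$ let $J'=(J^{[i-1]})_{\le d_i}\cdot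 K[x_1,\dots,x_i]$ and replace $J'$ by $J'+(\tau)$, where $\tau$ is the highest term of $\mathcal N(J')_{d_i}$ (if there is one). Then, for $t=d_i+1,\dots,d_1+\dots+d_i-i+1$ in this order, replace $J'$ by $J'+(\tau_1,\dots,\tau_h)$, where $\tau_1,\dots,\tau_h$ are the highest $h=\max\{0,\ |\mathcal E(\mathcal N(J')_{t-1})|-H^{[i]}(t)\}$ terms of the first expansion $\mathcal E(\mathcal N(J')_{t-1})$. The ideal obtained at the end is $J^{[i]}$. Then $x_1^{d_1},\dots,x_n^{d_n}$ is a regular sequence, and the ideal $J=J^{[n]}$ is almost revlex and satisfies $$H_{R/J}(t)=H_{R/(f_1,\dots,f_n)}(t)\qquad\text{for all } t\ge 0$$ for every regular sequence $f_1,\dots,f_n$ of forms in $R$ of degrees $d_1,\dots,d_n$. That is, the Hilbert function $H^{[n]}$ of a complete intersection of forms of these degrees admits an almost revlex ideal. Moreover $J$ is the only almost revlex ideal of $R$ with this Hilbert function. -/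

import Mathlib

open MvPolynomial

noncomputable section

namespace AlmostRevlex

/-- The term `x^a`, for an exponent vector `a`. The variable `x_i` of the text (`1 ≤ i ≤ n`) is
`X (i - 1)`. -/
def term (K : Type*) [Field K] {n : ℕ} (a : Fin n →₀ ℕ) : MvPolynomial (Fin n) K :=
  monomial a 1

/-- The Hilbert function of `R/I` for a homogeneous ideal `I`: the dimension of the degree `t` part
of `R/I`, which is the image in `R/I` of the space of forms of degree `t`. -/
def hilbertFunction {K : Type*} [Field K] {n : ℕ} (I : Ideal (MvPolynomial (Fin n) K)) (t : ℕ) :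
    ℕ :=
  Module.finrank K
    ((homogeneousSubmodule (Fin n) K t).map (Ideal.Quotient.mkₐ K I).toLinearMap)

/-- `DegRevLexGT a b` : `x^a ≻ x^b` for the degree reverse lexicographic order
with `x_1 ≻ ⋯ ≻ x_n`. -/
def DegRevLexGT {n : ℕ} (a b : Fin n →₀ ℕ) : Prop :=
  b.degree < a.degree ∨ (a.degree = b.degree ∧ ∃ i, a i < b i ∧ ∀ j, i < j → a j = b j)

/-- Monomial ideals. -/
def IsMonomialIdeal {K : Type*} [Field K] {n : ℕ} (J : Ideal (MvPolynomial (Fin n) K)) : Prop :=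
  ∃ S : Set (Fin n →₀ ℕ), J = Ideal.span (term K '' S)

/-- The (exponents of the) minimal monomial basis `B_J` of `J`: the terms of `J` that have no
proper divisor among the terms of `J`. -/
def minimalBasis {K : Type*} [Field K] {n : ℕ} (J : Ideal (MvPolynomial (Fin n) K)) :
    Set (Fin n →₀ ℕ) :=
  {a | term K a ∈ J ∧ ∀ b, b ≤ a → term K b ∈ J → b = a}

/-- Almost reverse lexicographic ideals. -/
def IsAlmostRevlex {K : Type*} [Field K] {n : ℕ} (J : Ideal (MvPolynomial (Fin n) K)) : Prop :=
  IsMonomialIdeal J ∧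
    ∀ a ∈ minimalBasis J, ∀ b : Fin n →₀ ℕ, b.degree = a.degree → DegRevLexGT b a → term K b ∈ J

/-- `f_1, …, f_n` is a regular sequence of forms of degrees `d_1, …, d_n` in `K[x_1, …, x_n]`,
so that the ideal they generate is a complete intersection. -/
def IsCompleteIntersection {K : Type*} [Field K] {n : ℕ} (d : Fin n → ℕ)
    (f : Fin n → MvPolynomial (Fin n) K) : Prop :=
  (∀ i, (f i).IsHomogeneous (d i)) ∧
    RingTheory.Sequence.IsRegular (MvPolynomial (Fin n) K) (List.ofFn f)

/-- The function `H^{[n]}`, read off from the complete intersection `(x_1^{d_1}, …, x_n^{d_n})`. -/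
def ciHilbertFunction (K : Type*) [Field K] {n : ℕ} (d : Fin n → ℕ) (t : ℕ) : ℕ :=
  hilbertFunction (Ideal.span (Set.range fun i => (X i : MvPolynomial (Fin n) K) ^ d i)) t

/-- The ideal `I_{≤ t}` generated by the homogeneous polynomials of degree at most `t` in `I`. -/
def truncation {K : Type*} [Field K] {n : ℕ} (I : Ideal (MvPolynomial (Fin n) K)) (t : ℕ) :
    Ideal (MvPolynomial (Fin n) K) :=
  Ideal.span {p | p ∈ I ∧ ∃ s, s ≤ t ∧ p.IsHomogeneous s}

/-- The degree `t` part `N(J)_t` of the sous-escalier: the terms of degree `t` outside `J`. -/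
def sousEscalier {K : Type*} [Field K] {n : ℕ} (J : Ideal (MvPolynomial (Fin n) K)) (t : ℕ) :
    Set (Fin n →₀ ℕ) :=
  {a | a.degree = t ∧ term K a ∉ J}

/-- The first expansion of `N(J)_t`: the terms of degree `t + 1` that are not the product of a
variable and a term of degree `t` in `J`. -/
def firstExpansion {K : Type*} [Field K] {n : ℕ} (J : Ideal (MvPolynomial (Fin n) K)) (t : ℕ) :
    Set (Fin n →₀ ℕ) :=
  {a | a.degree = t + 1 ∧
    ¬ ∃ (i : Fin n) (b : Fin n →₀ ℕ), b.degree = t ∧ term K b ∈ J ∧ a = b + Finsupp.single i 1}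

/-- The `h` highest terms of a finite set `N` of terms (all of them if `N` has at most `h`
elements). -/
def greatest {n : ℕ} (N : Set (Fin n →₀ ℕ)) (h : ℕ) : Set (Fin n →₀ ℕ) :=
  {a | a ∈ N ∧ {b | b ∈ N ∧ DegRevLexGT b a}.ncard < h}

/-- One pass in degree `t + 1`: add to `J` the highest terms of the first expansion of `N(J)_t`, as
many as are needed to bring the number of terms that remain down to `H (t + 1)`. -/
def addHighest {K : Type*} [Field K] {n : ℕ} (H : ℕ → ℕ) (J : Ideal (MvPolynomial (Fin n) K))
    (t : ℕ) : Ideal (MvPolynomial (Fin n) K) :=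
  J ⊔ Ideal.span
    (term K '' greatest (firstExpansion J t) ((firstExpansion J t).ncard - H (t + 1)))

/-- The ideal reached after the passes in the degrees `e + 1, …, e + k`, starting from `J`. -/
def addHighestIter {K : Type*} [Field K] {n : ℕ} (H : ℕ → ℕ)
    (J : Ideal (MvPolynomial (Fin n) K)) (e : ℕ) : ℕ → Ideal (MvPolynomial (Fin n) K)
  | 0 => J
  | k + 1 => addHighest H (addHighestIter H J e k) (e + k)

/-- The starting ideal in `K[x_1, …, x_{n+1}]` obtained from `J ⊆ K[x_1, …, x_n]` and a degree `e`:
extend `J_{≤ e}` to the larger ring and add the highest term of degree `e` outside this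
extension. -/
def startingIdeal {K : Type*} [Field K] {n : ℕ} (J : Ideal (MvPolynomial (Fin n) K)) (e : ℕ) :
    Ideal (MvPolynomial (Fin (n + 1)) K) :=
  let J' : Ideal (MvPolynomial (Fin (n + 1)) K) :=
    (truncation J e).map (rename Fin.castSucc : MvPolynomial (Fin n) K →ₐ[K] _)
  J' ⊔ Ideal.span (term K '' greatest (sousEscalier J' e) 1)

/-- The inductive construction of `J^{[n]}`. It starts from the zero ideal of `K` for `n = 0`
(whence `J^{[1]} = (x_1^{d_1})`), and obtains `J^{[n+1]}` from `J^{[n]}` by forming the starting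
ideal in degree `d_{n+1}` and then adding highest terms of the first expansion in the degrees
`d_{n+1} + 1, …, d_1 + ⋯ + d_{n+1} - (n + 1) + 1`. -/
def construction (K : Type*) [Field K] :
    (n : ℕ) → (Fin n → ℕ) → Ideal (MvPolynomial (Fin n) K)
  | 0, _ => ⊥
  | n + 1, d =>
    addHighestIter (ciHilbertFunction K d)
      (startingIdeal (construction K n (Fin.init d)) (d (Fin.last n)))
      (d (Fin.last n)) ((∑ i, d i) - (n + 1) + 1 - d (Fin.last n))

end AlmostRevlex

end

/-!
An almost revlex set `S` of terms can grow, from one degree to the next, only by an initial segment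
of its expansion (the terms without proper divisors in `S`). Hence an almost revlex ideal is
determined by its Hilbert function (`IsAlmostRevlexSet.eq_of_ncard_outside_eq`), and the
construction, which adds such initial segments, produces an almost revlex ideal whatever the
prescribed function is. It remains to see that it reaches the prescribed values, that is, that the
expansion never has fewer terms than should remain.

Modulo an almost revlex set, multiplication by the last variable has maximal rank
(`IsAlmostRevlexSet.mem_of_add_single_mem`). So the terms outside `S` in the first `n - j` variables
are counted by the `j`-fold truncated difference of the Hilbert function, where negative values are
replaced by `0` (`IsAlmostRevlexSet.iterate_posDiff`). By strong stability the expansion in degree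
`t + 1` has at least as many terms as the sum over `j < n` of these differences in degree `t`
(`IsAlmostRevlexSet.sum_le_ncard_expansion`). This suffices for every function whose `n`-fold
truncated difference vanishes in positive degrees (`IsRevlexSequence`), since the sum then
telescopes to a bound for the value in degree `t + 1` (`IsAlmostRevlexSet.le_ncard_expansion`).

The Hilbert function of the polynomial ring has this property, being that of the empty almost revlex
set, and the property survives multiplication of the series by `1 - z^d`, with negative values
replaced by `0` (`IsRevlexSequence.mulOneSubPow`): the sequences in question strictly increase up to
some point and do not increase afterwards, and for these the multiplication commutes with truncated
differences. As a form `f` of degree `d` that is regular modulo a homogeneous ideal multiplies the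
Hilbert series by `1 - z^d`, here without any truncation (`IsGraded.hilbertFunction_sup_span`), all
complete intersections of the given degrees share one Hilbert function, and it is a revlex sequence.

Finally, the starting ideals have the right Hilbert function up to degree `d_{n+1}`, by comparison
with the ideals of pure powers (`realizesUpTo_startingIdeal`), and the last degree of the
construction is one where the Hilbert function vanishes, so that no generators are missing.
-/

open MvPolynomial

noncomputable section

namespace AlmostRevlex

/-! ### Truncated differences of sequences -/

/-- The first difference of a sequence, with negative values replaced by `0`. -/
def posDiff (a : ℕ → ℕ) : ℕ → ℕ
  | 0 => a 0
  | t + 1 => a (t + 1) - a t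

/-- The coefficients of `(1 - z^d) ∑ a_t z^t`, with negative values replaced by `0`. -/
def mulOneSubPow (d : ℕ) (a : ℕ → ℕ) (t : ℕ) : ℕ :=
  if t < d then a t else a t - a (t - d)

/-- The sequences whose `n`-fold truncated difference vanishes in positive degrees. The Hilbert
functions of almost revlex ideals in `n` variables are of this kind. -/
def IsRevlexSequence (n : ℕ) (a : ℕ → ℕ) : Prop :=
  ∀ t, posDiff^[n] a (t + 1) = 0

lemma posDiff_le (a : ℕ → ℕ) (t : ℕ) : posDiff a t ≤ a t := by
  cases t <;> simp [posDiff]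

lemma mulOneSubPow_le (d : ℕ) (a : ℕ → ℕ) (t : ℕ) : mulOneSubPow d a t ≤ a t := by
  unfold mulOneSubPow; split_ifs <;> omega

lemma iterate_posDiff_congr {a b : ℕ → ℕ} {t : ℕ} (h : ∀ s ≤ t, a s = b s) (j : ℕ) :
    ∀ s ≤ t, posDiff^[j] a s = posDiff^[j] b s := by
  induction j with
  | zero => simpa using h
  | succ j ih =>
    intro s hs
    rw [Function.iterate_succ_apply', Function.iterate_succ_apply']
    cases s with
    | zero => exact ih 0 hs
    | succ s => simp only [posDiff, ih (s + 1) hs, ih s (by omega)]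

lemma le_sum_iterate_posDiff (a : ℕ → ℕ) (t k : ℕ) :
    a (t + 1) ≤ ∑ j ∈ Finset.range k, posDiff^[j] a t + posDiff^[k] a (t + 1) := by
  induction k with
  | zero => simp
  | succ k ih =>
    rw [Finset.sum_range_succ, Function.iterate_succ_apply']
    simp only [posDiff]
    omega

lemma IsRevlexSequence.posDiff {n : ℕ} {a : ℕ → ℕ} (h : IsRevlexSequence (n + 1) a) :
    IsRevlexSequence n (posDiff a) := h

/-- If a revlex sequence vanishes somewhere, it vanishes from there on: by
`le_sum_iterate_posDiff` each value is bounded by the iterated differences one step before. -/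
lemma IsRevlexSequence.eq_zero_succ {n : ℕ} {a : ℕ → ℕ} (h : IsRevlexSequence n a) {t : ℕ}
    (ht : a t = 0) : a (t + 1) = 0 := by
  have h1 := le_sum_iterate_posDiff a t n
  rw [h t, Finset.sum_eq_zero] at h1
  · omega
  · intro j _
    induction j with
    | zero => exact ht
    | succ j ih =>
      rw [Function.iterate_succ_apply']
      exact Nat.le_zero.1 ((posDiff_le _ _).trans (ih (by simp_all; omega)).le)

/-- Multiplication by `1 - z^d` commutes with taking differences, truncations included, as long as
the sequence is strictly increasing up to some point and nonincreasing afterwards. -/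
lemma posDiff_mulOneSubPow {d : ℕ} (hd : 0 < d) {a : ℕ → ℕ}
    (ha : ∀ t, posDiff a t = 0 → posDiff a (t + 1) = 0) :
    posDiff (mulOneSubPow d a) = mulOneSubPow d (posDiff a) := by
  have hz : ∀ {s t}, s ≤ t → posDiff a s = 0 → posDiff a t = 0 := by
    intro s t hst hs
    induction t, hst using Nat.le_induction with
    | base => exact hs
    | succ t _ ih => exact ha t ih
  funext t
  cases t with
  | zero => simp [posDiff, mulOneSubPow, hd]
  | succ t =>
    rcases lt_trichotomy (t + 1) d with h | h | h
    · simp [posDiff, mulOneSubPow, h, (by omega : t < d)]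
    · subst h
      simp [posDiff, mulOneSubPow]
      omega
    · obtain ⟨u, rfl⟩ : ∃ u, t = u + d := ⟨t - d, by omega⟩
      have e : u + d + 1 - d = u + 1 := by omega
      simp only [posDiff, mulOneSubPow, if_neg (by omega : ¬ u + d + 1 < d),
        if_neg (by omega : ¬ u + d < d), e, Nat.add_sub_cancel]
      by_cases h1 : a (u + d + 1) ≤ a (u + d)
      · by_cases h2 : a (u + 1) ≤ a u
        · have : ∀ v, u ≤ v → a (v + 1) ≤ a (u + 1) := by
            intro v hv
            induction v, hv using Nat.le_induction with
            | base => exact le_rfl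
            | succ v hv ih =>
              have := hz (s := u + 1) (t := v + 1 + 1) (by omega) (by simp [posDiff]; omega)
              simp only [posDiff] at this
              omega
          have := this (u + d) (by omega)
          omega
        · omega
      · have hpos : ∀ v, v ≤ u + d → a v < a (v + 1) := by
          intro v hv
          by_contra hc
          have := hz (s := v + 1) (t := u + d + 1) (by omega) (by simp [posDiff]; omega)
          simp only [posDiff] at this
          omega
        have hmono : ∀ v w, v ≤ w → w ≤ u + d + 1 → a v ≤ a w := by
          intro v w hvw
          induction w, hvw using Nat.le_induction with
          | base => exact fun _ => le_rfl
          | succ w _ ih =>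
            intro hw
            have := hpos w (by omega)
            have := ih (by omega)
            omega
        have h2 := hpos u (by omega)
        have h3 := hmono u (u + d) (by omega) (by omega)
        have h4 := hmono (u + 1) (u + d + 1) (by omega) le_rfl
        omega

/-- The revlex sequences are stable under multiplication by `1 - z^d`. This numerical fact is the
reason why the Hilbert functions of complete intersections admit almost revlex ideals. -/
lemma IsRevlexSequence.mulOneSubPow {n d : ℕ} (hd : 0 < d) {a : ℕ → ℕ}
    (h : IsRevlexSequence n a) : IsRevlexSequence n (mulOneSubPow d a) := by
  induction n generalizing a with
  | zero => exact fun t => Nat.le_zero.1 ((mulOneSubPow_le d a _).trans (h t).le)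
  | succ n ih =>
    have h' := h.posDiff
    intro t
    rw [Function.iterate_succ_apply, posDiff_mulOneSubPow hd fun t ht => h'.eq_zero_succ ht]
    exact ih h' t

/-! ### The degree reverse lexicographic order on terms of a fixed degree -/

section Order

variable {n : ℕ}

lemma degRevLexGT_irrefl (a : Fin n →₀ ℕ) : ¬ DegRevLexGT a a := by
  rintro (h | ⟨-, i, h, -⟩) <;> exact lt_irrefl _ h

lemma DegRevLexGT.trans {a b c : Fin n →₀ ℕ} (hab : DegRevLexGT a b) (hbc : DegRevLexGT b c) :
    DegRevLexGT a c := by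
  rcases hab with h | ⟨h, i, hi, hi'⟩
  · rcases hbc with h2 | ⟨h2, -⟩
    · exact Or.inl (h2.trans h)
    · exact Or.inl (h2 ▸ h)
  · rcases hbc with h2 | ⟨h2, j, hj, hj'⟩
    · exact Or.inl (h ▸ h2)
    · refine Or.inr ⟨h.trans h2, max i j, ?_, fun k hk => ?_⟩
      · rcases lt_trichotomy i j with hij | hij | hij
        · rw [max_eq_right hij.le, hi' j hij]; exact hj
        · subst hij; rw [max_self]; exact hi.trans hj
        · rw [max_eq_left hij.le, ← hj' i hij]; exact hi
      · rw [hi' k (lt_of_le_of_lt (le_max_left _ _) hk),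
          hj' k (lt_of_le_of_lt (le_max_right _ _) hk)]

lemma degRevLexGT_trichotomy {a b : Fin n →₀ ℕ} (h : a.degree = b.degree) :
    DegRevLexGT a b ∨ a = b ∨ DegRevLexGT b a := by
  by_cases hab : a = b
  · exact Or.inr (Or.inl hab)
  · have hne : (Finset.univ.filter fun i => a i ≠ b i).Nonempty := by
      obtain ⟨i, hi⟩ : ∃ i, a i ≠ b i := by
        by_contra hc
        push Not at hc
        exact hab (Finsupp.ext hc)
      exact ⟨i, by simpa using hi⟩
    set i := (Finset.univ.filter fun i => a i ≠ b i).max' hne with hi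
    have h1 : a i ≠ b i := by simpa using Finset.max'_mem _ hne
    have h2 : ∀ j, i < j → a j = b j := by
      intro j hj
      by_contra hc
      exact absurd (Finset.le_max' _ j (by simpa using hc)) (not_le.2 hj)
    rcases lt_or_gt_of_ne h1 with h3 | h3
    · exact Or.inl (Or.inr ⟨h, i, h3, h2⟩)
    · exact Or.inr (Or.inr (Or.inr ⟨h.symm, i, h3, fun j hj => (h2 j hj).symm⟩))

lemma finite_degree_eq (n t : ℕ) : {a : Fin n →₀ ℕ | a.degree = t}.Finite := by
  refine (Finset.finite_toSet (Finset.finsuppAntidiag Finset.univ t)).subset fun a ha => ?_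
  simpa [Finset.mem_finsuppAntidiag, ← Finsupp.degree_eq_sum] using ha

/-- Two initial segments of a finite set of terms of the same degree coincide if they have the same
number of elements. -/
lemma eq_of_ncard_eq_of_upper {t : ℕ} {E U V : Set (Fin n →₀ ℕ)} (hE : ∀ a ∈ E, a.degree = t)
    (hU : U ⊆ E) (hV : V ⊆ E) (hU' : ∀ a ∈ U, ∀ b ∈ E, DegRevLexGT b a → b ∈ U)
    (hV' : ∀ a ∈ V, ∀ b ∈ E, DegRevLexGT b a → b ∈ V) (h : U.ncard = V.ncard) : U = V := by
  have hfin : E.Finite := (finite_degree_eq n t).subset hE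
  by_cases hUV : U ⊆ V
  · exact Set.eq_of_subset_of_ncard_le hUV h.ge (hfin.subset hV)
  · obtain ⟨x, hxU, hxV⟩ := Set.not_subset.1 hUV
    refine (Set.eq_of_subset_of_ncard_le (fun v hv => ?_) h.le (hfin.subset hU)).symm
    rcases degRevLexGT_trichotomy ((hE x (hU hxU)).trans (hE v (hV hv)).symm) with h1 | h1 | h1
    · exact absurd (hV' v hv x (hU hxU) h1) hxV
    · exact absurd (h1 ▸ hv) hxV
    · exact hU' x hxU v (hV hv) h1

lemma greatest_upper {t : ℕ} {N : Set (Fin n →₀ ℕ)} (hN : ∀ a ∈ N, a.degree = t) {h : ℕ} :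
    ∀ a ∈ greatest N h, ∀ b ∈ N, DegRevLexGT b a → b ∈ greatest N h := by
  rintro a ⟨-, ha⟩ b hb hba
  refine ⟨hb, lt_of_le_of_lt (Set.ncard_le_ncard ?_ ?_) ha⟩
  · exact fun c hc => ⟨hc.1, hc.2.trans hba⟩
  · exact (finite_degree_eq n t).subset fun c hc => hN c hc.1

lemma ncard_greatest {t : ℕ} {N : Set (Fin n →₀ ℕ)} (hN : ∀ a ∈ N, a.degree = t) {h : ℕ}
    (hh : h ≤ N.ncard) : (greatest N h).ncard = h := by
  have hfin : N.Finite := (finite_degree_eq n t).subset hN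
  let rank : (Fin n →₀ ℕ) → ℕ := fun a => {b | b ∈ N ∧ DegRevLexGT b a}.ncard
  have hlt : ∀ a ∈ N, ∀ b, DegRevLexGT a b → rank a < rank b := by
    intro a ha b hab
    refine Set.ncard_lt_ncard ⟨fun c hc => ⟨hc.1, hc.2.trans hab⟩, fun hc => ?_⟩
      (hfin.subset fun c hc => hc.1)
    exact degRevLexGT_irrefl a (hc ⟨ha, hab⟩).2
  have hinj : Set.InjOn rank N := by
    intro a ha b hb hab
    rcases degRevLexGT_trichotomy ((hN a ha).trans (hN b hb).symm) with h1 | h1 | h1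
    · exact absurd hab (hlt a ha b h1).ne
    · exact h1
    · exact absurd hab (hlt b hb a h1).ne'
  have hcard : ∀ k, (Set.Iio k : Set ℕ).ncard = k := fun k => by
    rw [Set.ncard_eq_toFinset_card']; simp
  have himg : rank '' N = Set.Iio N.ncard := by
    refine Set.eq_of_subset_of_ncard_le ?_ ?_ (Set.finite_Iio _)
    · rintro _ ⟨a, ha, rfl⟩
      refine Set.ncard_lt_ncard ⟨fun c hc => hc.1, fun hc => ?_⟩ hfin
      exact degRevLexGT_irrefl a (hc ha).2
    · rw [hcard, hinj.ncard_image]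
  have himg' : rank '' greatest N h = Set.Iio h := by
    ext k
    constructor
    · rintro ⟨a, ha, rfl⟩
      exact ha.2
    · intro hk
      have : k ∈ rank '' N := himg ▸ lt_of_lt_of_le hk hh
      obtain ⟨a, ha, rfl⟩ := this
      exact ⟨a, ⟨ha, hk⟩, rfl⟩
  have hr := congrArg Set.ncard himg'
  rwa [(hinj.mono fun a ha => ha.1).ncard_image, hcard] at hr

end Order

/-! ### Almost revlex sets of terms -/

section Sets

variable {n : ℕ}

/-- The set of exponents of the terms in an almost revlex ideal: it is closed under
multiplication by terms, and with a minimal element it contains all the higher terms of the same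
degree. -/
def IsAlmostRevlexSet (S : Set (Fin n →₀ ℕ)) : Prop :=
  IsUpperSet S ∧ ∀ a ∈ S, (∀ b ≤ a, b ∈ S → b = a) →
    ∀ b : Fin n →₀ ℕ, b.degree = a.degree → DegRevLexGT b a → b ∈ S

/-- The terms of degree `t` outside `S`. -/
def outside (S : Set (Fin n →₀ ℕ)) (t : ℕ) : Set (Fin n →₀ ℕ) :=
  {a | a.degree = t ∧ a ∉ S}

/-- The terms of degree `t` outside `S` in which only the first `m` variables occur. -/
def outsideIn (S : Set (Fin n →₀ ℕ)) (m t : ℕ) : Set (Fin n →₀ ℕ) :=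
  {a | a.degree = t ∧ a ∉ S ∧ ∀ j : Fin n, m ≤ j → a j = 0}

/-- The terms of degree `t` without proper divisors in `S`. In positive degree, this is the first
expansion of the terms of degree `t - 1` outside `S`. -/
def expansion (S : Set (Fin n →₀ ℕ)) (t : ℕ) : Set (Fin n →₀ ℕ) :=
  {a | a.degree = t ∧ ∀ b < a, b ∉ S}

/-- `S` is generated by terms of degree at most `t`. -/
def GeneratedInDegreeLE (S : Set (Fin n →₀ ℕ)) (t : ℕ) : Prop :=
  ∀ a ∈ S, ∃ b ∈ S, b ≤ a ∧ b.degree ≤ t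

lemma finite_outside (S : Set (Fin n →₀ ℕ)) (t : ℕ) : (outside S t).Finite :=
  (finite_degree_eq n t).subset fun _ h => h.1

lemma finite_outsideIn (S : Set (Fin n →₀ ℕ)) (m t : ℕ) : (outsideIn S m t).Finite :=
  (finite_degree_eq n t).subset fun _ h => h.1

lemma finite_expansion (S : Set (Fin n →₀ ℕ)) (t : ℕ) : (expansion S t).Finite :=
  (finite_degree_eq n t).subset fun _ h => h.1

lemma outsideIn_self (S : Set (Fin n →₀ ℕ)) : outsideIn S n = outside S := by
  funext t
  ext a
  simp only [outsideIn, outside, Set.mem_ofPred_eq, and_congr_right_iff, and_iff_left_iff_imp]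
  exact fun _ _ j hj => absurd j.2 (by omega)

lemma degree_add_single (a : Fin n →₀ ℕ) (i : Fin n) :
    (a + Finsupp.single i 1).degree = a.degree + 1 := by
  rw [map_add, Finsupp.degree_single]

lemma degree_lt_of_lt {a b : Fin n →₀ ℕ} (h : a < b) : a.degree < b.degree := by
  rw [Finsupp.degree_eq_sum, Finsupp.degree_eq_sum]
  obtain ⟨h1, i, hi⟩ := Finsupp.lt_def.1 h
  exact Finset.sum_lt_sum (fun j _ => h1 j) ⟨i, Finset.mem_univ _, hi⟩

lemma exists_add_single_le {a b : Fin n →₀ ℕ} (h : a < b) :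
    ∃ i, a + Finsupp.single i 1 ≤ b := by
  obtain ⟨h1, i, hi⟩ := Finsupp.lt_def.1 h
  refine ⟨i, fun j => ?_⟩
  by_cases hij : i = j
  · subst hij; simpa using hi
  · simpa [Finsupp.single_apply, hij] using h1 j

lemma exists_between_degree {a b : Fin n →₀ ℕ} (h : a ≤ b) {s : ℕ} (h1 : a.degree ≤ s)
    (h2 : s ≤ b.degree) : ∃ c, a ≤ c ∧ c ≤ b ∧ c.degree = s := by
  induction s, h1 using Nat.le_induction with
  | base => exact ⟨a, le_rfl, h, rfl⟩
  | succ s _ ih =>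
    obtain ⟨c, hac, hcb, hc⟩ := ih (by omega)
    have hlt : c < b := lt_of_le_of_ne hcb (by rintro rfl; omega)
    obtain ⟨i, hi⟩ := exists_add_single_le hlt
    exact ⟨_, hac.trans le_self_add, hi, by rw [degree_add_single, hc]⟩

lemma exists_minimal_le {S : Set (Fin n →₀ ℕ)} {a : Fin n →₀ ℕ} (ha : a ∈ S) :
    ∃ g ∈ S, g ≤ a ∧ ∀ b ≤ g, b ∈ S → b = g := by
  induction h : a.degree using Nat.strong_induction_on generalizing a with
  | _ t ih =>
    by_cases hm : ∀ b ≤ a, b ∈ S → b = a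
    · exact ⟨a, ha, le_rfl, hm⟩
    · push Not at hm
      obtain ⟨b, hba, hb, hne⟩ := hm
      obtain ⟨g, hg, hgb, hmin⟩ := ih b.degree (h ▸ degree_lt_of_lt (lt_of_le_of_ne hba hne)) hb rfl
      exact ⟨g, hg, hgb.trans hba, hmin⟩

/-- Almost revlex sets are strongly stable, in the form used here. -/
lemma IsAlmostRevlexSet.add_single_mem {S : Set (Fin n →₀ ℕ)} (hS : IsAlmostRevlexSet S)
    {b : Fin n →₀ ℕ} {i m : Fin n} (hb : b ∉ S) (hm : b + Finsupp.single m 1 ∈ S) (hi : i < m) :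
    b + Finsupp.single i 1 ∈ S := by
  obtain ⟨g, hg, hgb, hmin⟩ := exists_minimal_le hm
  have hgm : g m = b m + 1 := by
    by_contra hne
    refine hb (hS.1 (fun j => ?_) hg)
    have hj := hgb j
    by_cases hjm : m = j
    · subst hjm
      simp at hj
      omega
    · simpa [Finsupp.single_apply, hjm] using hj
  obtain ⟨c, rfl⟩ : ∃ c, g = c + Finsupp.single m 1 := by
    refine ⟨g - Finsupp.single m 1, (tsub_add_cancel_of_le ?_).symm⟩
    simp [hgm]
  have hcb : c ≤ b := by simpa using hgb
  refine hS.1 (add_le_add_left hcb (Finsupp.single i 1))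
    (hS.2 _ hg hmin _ (by simp only [degree_add_single]) (Or.inr ⟨by simp only [degree_add_single],
      m, ?_, fun j hj => ?_⟩))
  · simp [hi.ne]
  · simp [hj.ne, (hi.trans hj).ne]

/-- Multiplication by the last variable has maximal rank modulo an almost revlex set: if it kills
a term of degree `t` outside `S`, then no term of degree `t + 1` outside `S` is free of this
variable. -/
lemma IsAlmostRevlexSet.mem_of_add_single_mem {S : Set (Fin n →₀ ℕ)} (hS : IsAlmostRevlexSet S)
    {c b : Fin n →₀ ℕ} {m : Fin n} (hc : c ∉ S) (hcm : ∀ j, m < j → c j = 0)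
    (hm : c + Finsupp.single m 1 ∈ S) (hb : b.degree = c.degree + 1)
    (hbm : ∀ j, m ≤ j → b j = 0) : b ∈ S := by
  obtain ⟨g, hg, hgc, hmin⟩ := exists_minimal_le hm
  have hgm : 0 < g m := by
    by_contra hne
    refine hc (hS.1 (fun j => ?_) hg)
    have hj := hgc j
    by_cases hjm : m = j
    · subst hjm; omega
    · simpa [Finsupp.single_apply, hjm] using hj
  have hdeg : g.degree ≤ b.degree := by
    rw [hb, ← degree_add_single c m]
    exact Finsupp.degree_mono hgc
  obtain ⟨h, -, hhb, hh⟩ := exists_between_degree (a := 0) (b := b) (fun _ => Nat.zero_le _)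
    (s := g.degree) (by rw [map_zero]; exact Nat.zero_le _) hdeg
  have hz : ∀ j, m ≤ j → h j = 0 := fun j hj => Nat.le_zero.1 ((hhb j).trans (hbm j hj).le)
  refine hS.1 hhb (hS.2 g hg hmin h hh (Or.inr ⟨hh, m, by rw [hz m le_rfl]; exact hgm, ?_⟩))
  intro j hj
  have := hgc j
  simp only [Finsupp.add_apply, hcm j hj, Finsupp.single_apply, hj.ne, if_false] at this
  rw [hz j hj.le]
  omega

lemma add_single_injective (i : Fin n) :
    Function.Injective fun c : Fin n →₀ ℕ => c + Finsupp.single i 1 :=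
  fun _ _ h => add_right_cancel h

lemma IsAlmostRevlexSet.ncard_outsideIn {S : Set (Fin n →₀ ℕ)} (hS : IsAlmostRevlexSet S)
    {m : ℕ} (hm : m < n) :
    (fun t => (outsideIn S m t).ncard) = posDiff fun t => (outsideIn S (m + 1) t).ncard := by
  funext t
  cases t with
  | zero =>
    simp only [posDiff]
    congr 1
    ext a
    simp only [outsideIn, Set.mem_ofPred_eq, Finsupp.degree_eq_zero_iff]
    constructor
    all_goals
      rintro ⟨rfl, h, -⟩
      exact ⟨rfl, h, by simp⟩
  | succ t =>
    let e : Fin n := ⟨m, hm⟩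
    let Q : Set (Fin n →₀ ℕ) := {c | c ∈ outsideIn S (m + 1) t ∧ c + Finsupp.single e 1 ∉ S}
    have hQf : Q.Finite := (finite_outsideIn S (m + 1) t).subset fun c hc => hc.1
    have hdec : outsideIn S (m + 1) (t + 1) =
        outsideIn S m (t + 1) ∪ (fun c => c + Finsupp.single e 1) '' Q := by
      ext a
      constructor
      · rintro ⟨h1, h2, h3⟩
        by_cases ha : a e = 0
        · refine Or.inl ⟨h1, h2, fun j hj => ?_⟩
          rcases Nat.lt_or_ge m j with hj' | hj'
          · exact h3 j hj'
          · rwa [show j = e from Fin.ext (le_antisymm hj' hj)]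
        · have hle : Finsupp.single e 1 ≤ a := by simp; omega
          have hadd : a - Finsupp.single e 1 + Finsupp.single e 1 = a := tsub_add_cancel_of_le hle
          refine Or.inr ⟨a - Finsupp.single e 1, ⟨⟨?_, ?_, ?_⟩, ?_⟩, hadd⟩
          · have := degree_add_single (a - Finsupp.single e 1) e
            rw [hadd] at this
            omega
          · exact fun hc => h2 (hS.1 tsub_le_self hc)
          · intro j hj
            simp [h3 j hj]
          · rwa [hadd]
      · rintro (⟨h1, h2, h3⟩ | ⟨c, ⟨⟨h1, h2, h3⟩, h4⟩, rfl⟩)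
        · exact ⟨h1, h2, fun j hj => h3 j (by omega)⟩
        · refine ⟨by simp only [degree_add_single, h1], h4, fun j hj => ?_⟩
          have hne : e ≠ j := fun h => by
            have := congrArg Fin.val h
            simp [e] at this
            omega
          simp [h3 j hj, hne]
    have hdisj : Disjoint (outsideIn S m (t + 1)) ((fun c => c + Finsupp.single e 1) '' Q) := by
      rw [Set.disjoint_left]
      rintro _ ⟨-, -, h3⟩ ⟨c, -, rfl⟩
      have := h3 e le_rfl
      simp at this
    have hcard := congrArg Set.ncard hdec
    rw [Set.ncard_union_eq hdisj (finite_outsideIn _ _ _) (hQf.image _),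
      Set.ncard_image_of_injective _ (add_single_injective e)] at hcard
    have hQle : Q.ncard ≤ (outsideIn S (m + 1) t).ncard :=
      Set.ncard_le_ncard (fun c hc => hc.1) (finite_outsideIn _ _ _)
    simp only [posDiff]
    by_cases hQ : Q = outsideIn S (m + 1) t
    · rw [hQ] at hcard
      omega
    · have hempty : outsideIn S m (t + 1) = ∅ := by
        obtain ⟨c, hc, hcQ⟩ : ∃ c ∈ outsideIn S (m + 1) t, c ∉ Q := by
          by_contra hcon
          push Not at hcon
          exact hQ (Set.Subset.antisymm (fun c hc => hc.1) hcon)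
        have hcS : c + Finsupp.single e 1 ∈ S := by
          by_contra h
          exact hcQ ⟨hc, h⟩
        refine Set.eq_empty_iff_forall_notMem.2 fun b hb => hb.2.1 ?_
        exact hS.mem_of_add_single_mem hc.2.1 (fun j hj => hc.2.2 j hj) hcS
          (by rw [hb.1, hc.1]) (fun j hj => hb.2.2 j hj)
      rw [hempty, Set.ncard_empty] at hcard ⊢
      omega

lemma IsAlmostRevlexSet.iterate_posDiff {S : Set (Fin n →₀ ℕ)} (hS : IsAlmostRevlexSet S)
    {j : ℕ} (hj : j ≤ n) :
    posDiff^[j] (fun t => (outside S t).ncard) = fun t => (outsideIn S (n - j) t).ncard := by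
  induction j with
  | zero => simp [outsideIn_self]
  | succ j ih =>
    rw [Function.iterate_succ_apply', ih (by omega), hS.ncard_outsideIn (by omega : n - (j + 1) < n),
      show n - (j + 1) + 1 = n - j by omega]

lemma IsAlmostRevlexSet.isRevlexSequence {S : Set (Fin n →₀ ℕ)} (hS : IsAlmostRevlexSet S) :
    IsRevlexSequence n fun t => (outside S t).ncard := by
  intro t
  rw [hS.iterate_posDiff le_rfl, Nat.sub_self, Set.ncard_eq_zero (finite_outsideIn _ _ _),
    Set.eq_empty_iff_forall_notMem]
  rintro a ⟨h1, -, h2⟩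
  have : a = 0 := Finsupp.ext fun j => h2 j (Nat.zero_le _)
  simp [this] at h1

/-- Multiplying the terms outside `S` in the first `m + 1` variables by the variable of index `m`,
for each `m`, produces distinct elements of the expansion. -/
lemma IsAlmostRevlexSet.sum_le_ncard_expansion {S : Set (Fin n →₀ ℕ)} (hS : IsAlmostRevlexSet S)
    (t : ℕ) :
    ∑ m ∈ Finset.range n, (outsideIn S (m + 1) t).ncard ≤ (expansion S (t + 1)).ncard := by
  suffices h : ∀ k ≤ n, ∑ m ∈ Finset.range k, (outsideIn S (m + 1) t).ncard ≤
      {a | a ∈ expansion S (t + 1) ∧ ∀ j : Fin n, k ≤ j → a j = 0}.ncard from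
    (h n le_rfl).trans (Set.ncard_le_ncard (fun a ha => ha.1) (finite_expansion _ _))
  intro k
  induction k with
  | zero => simp
  | succ k ih =>
    intro hk
    let e : Fin n := ⟨k, hk⟩
    rw [Finset.sum_range_succ]
    refine (Nat.add_le_add_right (ih (by omega)) _).trans ?_
    rw [← Set.ncard_image_of_injective (outsideIn S (k + 1) t) (add_single_injective e),
      ← Set.ncard_union_eq ?_ ((finite_expansion S (t + 1)).subset fun a ha => ha.1)
        ((finite_outsideIn _ _ _).image _)]
    · refine Set.ncard_le_ncard ?_ ((finite_expansion S (t + 1)).subset fun a ha => ha.1)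
      rintro a (⟨h1, h2⟩ | ⟨c, ⟨h1, h2, h3⟩, rfl⟩)
      · exact ⟨h1, fun j hj => h2 j (by omega)⟩
      · refine ⟨⟨by simp only [degree_add_single, h1], fun b hb hbS => ?_⟩, fun j hj => ?_⟩
        · simp only at hb
          -- A proper divisor of `c x_e` in `S` involves one more `x_e` than `c`; exchanging it
          -- for an earlier variable by stability gives a divisor of `c`.
          have hbe : c e < b e := by
            by_contra hle
            refine h2 (hS.1 (fun j => ?_) hbS)
            have := hb.le j
            by_cases hj : e = j
            · subst hj; omega
            · simpa [Finsupp.single_apply, hj] using this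
          obtain ⟨b', rfl⟩ : ∃ b', b = b' + Finsupp.single e 1 :=
            ⟨b - Finsupp.single e 1, (tsub_add_cancel_of_le (by simp; omega)).symm⟩
          have hb' : b' < c := by simpa using hb
          obtain ⟨i, hi⟩ := exists_add_single_le hb'
          have hci : c i ≠ 0 := by
            have := hi i
            simp at this
            omega
          have hie : i < e := by
            have h4 : (i : ℕ) ≤ k := by
              by_contra hc
              exact hci (h3 i (by omega))
            refine lt_of_le_of_ne h4 ?_
            rintro rfl
            have h5 := hi e
            simp at h5 hbe
            omega
          exact h2 (hS.1 hi (hS.add_single_mem (fun h => h2 (hS.1 hb'.le h)) hbS hie))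
        · have hne : e ≠ j := fun h => by
            have := congrArg Fin.val h
            simp [e] at this
            omega
          simp [h3 j hj, hne]
    · rw [Set.disjoint_left]
      rintro _ ⟨-, h3⟩ ⟨c, -, rfl⟩
      have := h3 e le_rfl
      simp at this

/-- If an almost revlex set realizes a revlex sequence up to degree `t`, there are enough terms in
the next expansion to realize it in degree `t + 1` too. -/
lemma IsAlmostRevlexSet.le_ncard_expansion {S : Set (Fin n →₀ ℕ)} (hS : IsAlmostRevlexSet S)
    {a : ℕ → ℕ} (ha : IsRevlexSequence n a) {t : ℕ} (h : ∀ s ≤ t, (outside S s).ncard = a s) :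
    a (t + 1) ≤ (expansion S (t + 1)).ncard := by
  refine le_trans ?_ (hS.sum_le_ncard_expansion t)
  have h1 := le_sum_iterate_posDiff a t n
  rw [ha t, add_zero] at h1
  refine h1.trans (le_of_eq ?_)
  rw [← Finset.sum_range_reflect (fun m => (outsideIn S (m + 1) t).ncard)]
  refine Finset.sum_congr rfl fun j hj => ?_
  have hj' : j < n := Finset.mem_range.1 hj
  rw [← iterate_posDiff_congr h j t le_rfl, hS.iterate_posDiff hj'.le,
    show n - 1 - j + 1 = n - j by omega]

/-- An almost revlex set is determined by the number of terms outside it in each degree: in each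
degree its new elements form an initial segment of the expansion. -/
lemma IsAlmostRevlexSet.eq_of_ncard_outside_eq {S T : Set (Fin n →₀ ℕ)}
    (hS : IsAlmostRevlexSet S) (hT : IsAlmostRevlexSet T)
    (h : ∀ t, (outside S t).ncard = (outside T t).ncard) : S = T := by
  suffices key : ∀ t, ∀ a : Fin n →₀ ℕ, a.degree = t → (a ∈ S ↔ a ∈ T) from
    Set.ext fun a => key _ a rfl
  intro t
  induction t using Nat.strong_induction_on with
  | _ t ih =>
    have hE : expansion S t = expansion T t := by
      ext a
      refine and_congr_right fun ha => forall₂_congr fun b hb => not_congr ?_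
      exact ih _ (ha ▸ degree_lt_of_lt hb) b rfl
    have upper : ∀ {U : Set (Fin n →₀ ℕ)}, IsAlmostRevlexSet U → ∀ a ∈ U ∩ expansion U t,
        ∀ b ∈ expansion U t, DegRevLexGT b a → b ∈ U ∩ expansion U t := by
      rintro U hU a ⟨haU, ha⟩ b hb hba
      refine ⟨hU.2 a haU (fun c hc hcU => ?_) b (hb.1.trans ha.1.symm) hba, hb⟩
      by_contra hne
      exact ha.2 c (lt_of_le_of_ne hc hne) hcU
    have count : ∀ {U : Set (Fin n →₀ ℕ)}, IsAlmostRevlexSet U →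
        (U ∩ expansion U t).ncard + (outside U t).ncard = (expansion U t).ncard := by
      intro U hU
      rw [← Set.ncard_union_eq _ ((finite_expansion U t).subset Set.inter_subset_right)
        (finite_outside U t)]
      · congr 1
        ext a
        constructor
        · rintro (⟨-, ha⟩ | ⟨h1, h2⟩)
          · exact ha
          · exact ⟨h1, fun b hb hbU => h2 (hU.1 hb.le hbU)⟩
        · intro ha
          by_cases haU : a ∈ U
          · exact Or.inl ⟨haU, ha⟩
          · exact Or.inr ⟨ha.1, haU⟩
      · rw [Set.disjoint_left]
        exact fun a ha ha' => ha'.2 ha.1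
    have hST : S ∩ expansion S t = T ∩ expansion S t := by
      refine eq_of_ncard_eq_of_upper (E := expansion S t) (fun a ha => ha.1)
        Set.inter_subset_right Set.inter_subset_right (upper hS) (hE ▸ upper hT) ?_
      have h1 := count hS
      have h2 := count hT
      rw [← hE] at h2
      have h3 := h t
      omega
    intro a ha
    by_cases hae : a ∈ expansion S t
    · exact ⟨fun hm => (hST.le ⟨hm, hae⟩).1, fun hm => (hST.ge ⟨hm, hae⟩).1⟩
    · obtain ⟨b, hb, hbS⟩ : ∃ b < a, b ∈ S := by
        by_contra hcon
        push Not at hcon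
        exact hae ⟨ha, hcon⟩
      have hbT := (ih _ (ha ▸ degree_lt_of_lt hb) b rfl).1 hbS
      exact ⟨fun _ => hT.1 hb.le hbT, fun _ => hS.1 hb.le hbS⟩

lemma expansion_eq_outside {S : Set (Fin n →₀ ℕ)} (hS : IsUpperSet S) {t : ℕ}
    (hg : GeneratedInDegreeLE S t) : expansion S (t + 1) = outside S (t + 1) := by
  ext a
  refine and_congr_right fun ha => ⟨fun h haS => ?_, fun h b hb hbS => h (hS hb.le hbS)⟩
  obtain ⟨b, hb, hba, hbt⟩ := hg a haS
  exact h b (lt_of_le_of_ne hba (by rintro rfl; omega)) hb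

/-- The set of terms obtained from `S` by adding the `h` highest terms of degree `t` outside `S`,
with all their multiples. -/
def addTop (S : Set (Fin n →₀ ℕ)) (t h : ℕ) : Set (Fin n →₀ ℕ) :=
  S ∪ {a | ∃ b ∈ greatest (outside S t) h, b ≤ a}

lemma greatest_subset {N : Set (Fin n →₀ ℕ)} {h : ℕ} : greatest N h ⊆ N := fun _ ha => ha.1

lemma IsAlmostRevlexSet.addTop {S : Set (Fin n →₀ ℕ)} (hS : IsAlmostRevlexSet S) (t h : ℕ) :
    IsAlmostRevlexSet (addTop S t h) := by
  constructor
  · rintro a b hab (ha | ⟨c, hc, hca⟩)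
    · exact Or.inl (hS.1 hab ha)
    · exact Or.inr ⟨c, hc, hca.trans hab⟩
  · rintro a (ha | ⟨c, hc, hca⟩) hmin b hb hba
    · exact Or.inl (hS.2 a ha (fun c hc hcS => hmin c hc (Or.inl hcS)) b hb hba)
    · obtain rfl := hmin c hca (Or.inr ⟨c, hc, le_rfl⟩)
      by_cases hbS : b ∈ S
      · exact Or.inl hbS
      · exact Or.inr ⟨b, greatest_upper (fun a ha => ha.1) c hc b
          ⟨hb.trans (greatest_subset hc).1, hbS⟩ hba, le_rfl⟩

lemma GeneratedInDegreeLE.addTop {S : Set (Fin n →₀ ℕ)} {t : ℕ} (hS : GeneratedInDegreeLE S t)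
    (h : ℕ) : GeneratedInDegreeLE (addTop S t h) t := by
  rintro a (ha | ⟨c, hc, hca⟩)
  · obtain ⟨b, hb, hba⟩ := hS a ha
    exact ⟨b, Or.inl hb, hba⟩
  · exact ⟨c, Or.inr ⟨c, hc, le_rfl⟩, hca, (greatest_subset hc).1.le⟩

lemma outside_addTop_of_lt (S : Set (Fin n →₀ ℕ)) {s t : ℕ} (hst : s < t) (h : ℕ) :
    outside (addTop S t h) s = outside S s := by
  ext a
  refine and_congr_right fun ha => not_congr ⟨?_, Or.inl⟩
  rintro (ha' | ⟨c, hc, hca⟩)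
  · exact ha'
  · have := Finsupp.degree_mono hca
    have := (greatest_subset hc).1
    omega

lemma ncard_outside_addTop (S : Set (Fin n →₀ ℕ)) {t h : ℕ} (hh : h ≤ (outside S t).ncard) :
    (outside (addTop S t h) t).ncard = (outside S t).ncard - h := by
  have hd : outside (addTop S t h) t = outside S t \ greatest (outside S t) h := by
    ext a
    constructor
    · rintro ⟨h1, h2⟩
      exact ⟨⟨h1, fun ha => h2 (Or.inl ha)⟩, fun ha => h2 (Or.inr ⟨a, ha, le_rfl⟩)⟩
    · rintro ⟨⟨h1, h2⟩, h3⟩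
      refine ⟨h1, ?_⟩
      rintro (ha | ⟨c, hc, hca⟩)
      · exact h2 ha
      · rcases hca.eq_or_lt with rfl | hlt
        · exact h3 hc
        · have := degree_lt_of_lt hlt
          have := (greatest_subset hc).1
          omega
  rw [hd, Set.ncard_sdiff greatest_subset ((finite_outside S t).subset greatest_subset),
    ncard_greatest (fun a ha => ha.1) hh]

/-- One step of the construction: it corrects the number of terms outside `S` in degree
`t + 1`. -/
lemma IsAlmostRevlexSet.ncard_outside_addTop_eq {S : Set (Fin n →₀ ℕ)} (hS : IsAlmostRevlexSet S)
    {a : ℕ → ℕ} (ha : IsRevlexSequence n a) {t : ℕ} (hg : GeneratedInDegreeLE S t)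
    (h : ∀ s ≤ t, (outside S s).ncard = a s) :
    ∀ s ≤ t + 1, (outside (AlmostRevlex.addTop S (t + 1)
      ((outside S (t + 1)).ncard - a (t + 1))) s).ncard = a s := by
  intro s hs
  rcases hs.lt_or_eq with hs | rfl
  · rw [outside_addTop_of_lt S hs, h s (by omega)]
  · have := hS.le_ncard_expansion ha h
    rw [expansion_eq_outside hS.1 hg] at this
    rw [ncard_outside_addTop S (Nat.sub_le _ _)]
    omega

lemma GeneratedInDegreeLE.mono {S : Set (Fin n →₀ ℕ)} {s t : ℕ} (hS : GeneratedInDegreeLE S s)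
    (hst : s ≤ t) : GeneratedInDegreeLE S t := fun a ha =>
  let ⟨b, hb, hba, hbs⟩ := hS a ha
  ⟨b, hb, hba, hbs.trans hst⟩

lemma outside_eq_empty_of_le {S : Set (Fin n →₀ ℕ)} (hS : IsUpperSet S) {s t : ℕ}
    (h : outside S s = ∅) (hst : s ≤ t) : outside S t = ∅ := by
  refine Set.eq_empty_iff_forall_notMem.2 fun a ha => ?_
  obtain ⟨c, -, hca, hc⟩ := exists_between_degree (a := 0) (b := a) (fun _ => Nat.zero_le _)
    (s := s) (by rw [map_zero]; exact Nat.zero_le _) (ha.1 ▸ hst)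
  exact Set.eq_empty_iff_forall_notMem.1 h c ⟨hc, fun hcS => ha.2 (hS hca hcS)⟩

end Sets

/-! ### Extending sets of terms by one variable -/

section Extend

variable {n : ℕ}

/-- The exponent vector without its last entry. -/
def dropLast (a : Fin (n + 1) →₀ ℕ) : Fin n →₀ ℕ :=
  a.comapDomain Fin.castSucc (Fin.castSucc_injective n).injOn

/-- The exponent vector `a` followed by `k`. -/
def append (a : Fin n →₀ ℕ) (k : ℕ) : Fin (n + 1) →₀ ℕ :=
  a.mapDomain Fin.castSucc + Finsupp.single (Fin.last n) k

@[simp]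
lemma dropLast_apply (a : Fin (n + 1) →₀ ℕ) (i : Fin n) : dropLast a i = a i.castSucc := rfl

@[simp]
lemma append_castSucc (a : Fin n →₀ ℕ) (k : ℕ) (i : Fin n) : append a k i.castSucc = a i := by
  simp [append, Finsupp.mapDomain_apply (Fin.castSucc_injective n)]

@[simp]
lemma append_last (a : Fin n →₀ ℕ) (k : ℕ) : append a k (Fin.last n) = k := by
  have h : Fin.last n ∉ Set.range (Fin.castSucc : Fin n → Fin (n + 1)) := by
    rintro ⟨i, hi⟩
    exact i.castSucc_ne_last hi
  simp [append, Finsupp.mapDomain_of_notMem_range _ _ h]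

@[simp]
lemma dropLast_append (a : Fin n →₀ ℕ) (k : ℕ) : dropLast (append a k) = a := by
  ext i; simp

lemma append_dropLast (a : Fin (n + 1) →₀ ℕ) : append (dropLast a) (a (Fin.last n)) = a := by
  ext i
  refine Fin.lastCases ?_ (fun j => ?_) i <;> simp

lemma degree_eq_dropLast_add (a : Fin (n + 1) →₀ ℕ) :
    a.degree = (dropLast a).degree + a (Fin.last n) := by
  simp [Finsupp.degree_eq_sum, Fin.sum_univ_castSucc]

lemma degree_append (a : Fin n →₀ ℕ) (k : ℕ) : (append a k).degree = a.degree + k := by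
  simp [degree_eq_dropLast_add]

lemma append_zero_le_iff {b : Fin n →₀ ℕ} {a : Fin (n + 1) →₀ ℕ} :
    append b 0 ≤ a ↔ b ≤ dropLast a := by
  refine ⟨fun h i => by simpa using h i.castSucc, fun h i => ?_⟩
  refine Fin.lastCases ?_ (fun j => ?_) i
  · simp
  · simpa using h j

lemma dropLast_mono {a b : Fin (n + 1) →₀ ℕ} (h : a ≤ b) : dropLast a ≤ dropLast b :=
  fun i => h i.castSucc

/-- The terms in `n + 1` variables that become elements of `S` when the last variable is put equal
to `1`. If `S` is the set of terms of an ideal, this is the set of terms of its extension. -/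
def extend (S : Set (Fin n →₀ ℕ)) : Set (Fin (n + 1) →₀ ℕ) :=
  {a | dropLast a ∈ S}

lemma append_mem_extend {S : Set (Fin n →₀ ℕ)} {b : Fin n →₀ ℕ} {k : ℕ} :
    append b k ∈ extend S ↔ b ∈ S := by
  simp [extend]

lemma IsAlmostRevlexSet.extend {S : Set (Fin n →₀ ℕ)} (hS : IsAlmostRevlexSet S) :
    IsAlmostRevlexSet (extend S) := by
  refine ⟨fun a b hab ha => hS.1 (dropLast_mono hab) ha, fun a ha hmin b hb hba => ?_⟩
  have ha0 : append (dropLast a) 0 = a :=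
    hmin _ (append_zero_le_iff.2 le_rfl) (append_mem_extend.2 ha)
  have hlast : a (Fin.last n) = 0 := by rw [← ha0, append_last]
  rcases hba with h | ⟨-, i, hi, hi'⟩
  · exact absurd h (by omega)
  obtain ⟨i, rfl⟩ : ∃ j : Fin n, i = j.castSucc := by
    have hne : i ≠ Fin.last n := by
      rintro rfl
      omega
    obtain ⟨j, rfl⟩ := Fin.exists_castSucc_eq.2 hne
    exact ⟨j, rfl⟩
  have hblast : b (Fin.last n) = 0 := by rw [hi' _ i.castSucc_lt_last, hlast]
  have hd : (dropLast b).degree = (dropLast a).degree := by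
    have h1 := degree_eq_dropLast_add a
    have h2 := degree_eq_dropLast_add b
    omega
  refine hS.2 (dropLast a) ha (fun c hc hcS => ?_) (dropLast b) hd
    (Or.inr ⟨hd, i, hi, fun j hj => hi' j.castSucc (Fin.castSucc_lt_castSucc_iff.2 hj)⟩)
  have := hmin (append c 0) (append_zero_le_iff.2 hc) (append_mem_extend.2 hcS)
  rw [← this, dropLast_append]

lemma GeneratedInDegreeLE.extend {S : Set (Fin n →₀ ℕ)} {t : ℕ} (hS : GeneratedInDegreeLE S t) :
    GeneratedInDegreeLE (extend S) t := by
  intro a ha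
  obtain ⟨b, hb, hba, hbt⟩ := hS _ ha
  exact ⟨append b 0, append_mem_extend.2 hb, append_zero_le_iff.2 hba, by rwa [degree_append]⟩

lemma ncard_outside_extend (S : Set (Fin n →₀ ℕ)) (t : ℕ) :
    (outside (extend S) t).ncard = ∑ u ∈ Finset.range (t + 1), (outside S u).ncard := by
  have h1 : outside (extend S) t =
      (fun b => append b (t - b.degree)) '' {b | b ∉ S ∧ b.degree ≤ t} := by
    ext a
    have hdeg := degree_eq_dropLast_add a
    constructor
    · rintro ⟨h1, h2⟩
      refine ⟨dropLast a, ⟨h2, by omega⟩, ?_⟩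
      simp only
      rw [show t - (dropLast a).degree = a (Fin.last n) by omega, append_dropLast]
    · rintro ⟨b, ⟨h2, h3⟩, rfl⟩
      exact ⟨by rw [degree_append]; omega, by rwa [append_mem_extend]⟩
  have hinj : Set.InjOn (fun b : Fin n →₀ ℕ => append b (t - b.degree))
      {b | b ∉ S ∧ b.degree ≤ t} := by
    intro b _ c _ h
    simpa using congrArg dropLast h
  have hfin : ∀ t, {b : Fin n →₀ ℕ | b ∉ S ∧ b.degree ≤ t}.Finite := fun t =>
    ((Set.finite_Iic t).biUnion fun u _ => finite_degree_eq n u).subset fun b hb =>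
      Set.mem_biUnion (show b.degree ∈ Set.Iic t from hb.2) rfl
  rw [h1, hinj.ncard_image]
  clear h1 hinj
  induction t with
  | zero =>
    simp only [zero_add, Finset.range_one, Finset.sum_singleton, Nat.le_zero]
    congr 1
    ext a
    exact and_comm
  | succ t ih =>
    rw [Finset.sum_range_succ, ← ih, ← Set.ncard_union_eq _ (hfin t) (finite_outside S _)]
    · congr 1
      ext a
      constructor
      · rintro ⟨h1, h2⟩
        rcases Nat.lt_or_ge t a.degree with h | h
        · exact Or.inr ⟨by omega, h1⟩
        · exact Or.inl ⟨h1, h⟩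
      · rintro (⟨h1, h2⟩ | ⟨h1, h2⟩)
        · exact ⟨h1, by omega⟩
        · exact ⟨h2, h1.le⟩
    · rw [Set.disjoint_left]
      rintro a ⟨-, h1⟩ ⟨h2, -⟩
      omega

/-- The multiples of the elements of `S` of degree at most `t`. -/
def truncate (S : Set (Fin n →₀ ℕ)) (t : ℕ) : Set (Fin n →₀ ℕ) :=
  {a | ∃ b ∈ S, b ≤ a ∧ b.degree ≤ t}

lemma generatedInDegreeLE_truncate (S : Set (Fin n →₀ ℕ)) (t : ℕ) :
    GeneratedInDegreeLE (truncate S t) t := by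
  rintro a ⟨b, hb, hba, hbt⟩
  exact ⟨b, ⟨b, hb, le_rfl, hbt⟩, hba, hbt⟩

lemma IsAlmostRevlexSet.truncate {S : Set (Fin n →₀ ℕ)} (hS : IsAlmostRevlexSet S) (t : ℕ) :
    IsAlmostRevlexSet (truncate S t) := by
  constructor
  · rintro a b hab ⟨c, hc, hca, hct⟩
    exact ⟨c, hc, hca.trans hab, hct⟩
  · rintro a ⟨c, hc, hca, hct⟩ hmin b hb hba
    obtain rfl := hmin c hca ⟨c, hc, le_rfl, hct⟩
    refine ⟨b, hS.2 c hc (fun e he heS => ?_) b hb hba, le_rfl, hb.trans_le hct⟩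
    exact hmin e he ⟨e, heS, le_rfl, (Finsupp.degree_mono he).trans hct⟩

lemma outside_truncate {S : Set (Fin n →₀ ℕ)} (hS : IsUpperSet S) {s t : ℕ} (hst : s ≤ t) :
    outside (truncate S t) s = outside S s := by
  ext a
  refine and_congr_right fun ha => not_congr ⟨?_, fun h => ⟨a, h, le_rfl, ha.trans_le hst⟩⟩
  rintro ⟨b, hb, hba, -⟩
  exact hS hba hb

/-! ### The terms of the ideal of pure powers -/

/-- The terms divisible by `x_i^{d_i}` for some `i`. -/
def purePowers (d : Fin n → ℕ) : Set (Fin n →₀ ℕ) :=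
  {a | ∃ i, d i ≤ a i}

lemma purePowers_succ (d : Fin (n + 1) → ℕ) :
    purePowers d = extend (purePowers (Fin.init d)) ∪ {a | d (Fin.last n) ≤ a (Fin.last n)} := by
  ext a
  constructor
  · rintro ⟨i, hi⟩
    induction i using Fin.lastCases with
    | last => exact Or.inr hi
    | cast j => exact Or.inl ⟨j, hi⟩
  · rintro (⟨j, hj⟩ | h)
    · exact ⟨j.castSucc, hj⟩
    · exact ⟨_, h⟩

lemma outside_purePowers_of_lt (d : Fin (n + 1) → ℕ) {s : ℕ} (hs : s < d (Fin.last n)) :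
    outside (purePowers d) s = outside (extend (purePowers (Fin.init d))) s := by
  rw [purePowers_succ]
  ext a
  refine and_congr_right fun ha => not_congr ⟨?_, Or.inl⟩
  rintro (h | h)
  · exact h
  · have h1 := degree_eq_dropLast_add a
    have h2 : d (Fin.last n) ≤ a (Fin.last n) := h
    omega

/-- In degree `d_{n+1}`, the only term divisible by `x_{n+1}^{d_{n+1}}` is this power itself. -/
lemma ncard_outside_purePowers_last {d : Fin (n + 1) → ℕ} (hd : ∀ i, 0 < d i) :
    (outside (purePowers d) (d (Fin.last n))).ncard + 1 =
      (outside (extend (purePowers (Fin.init d))) (d (Fin.last n))).ncard := by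
  have hz : (0 : Fin n →₀ ℕ) ∉ purePowers (Fin.init d) := by
    rintro ⟨i, hi⟩
    exact absurd hi (not_le.2 (hd i.castSucc))
  have hmem : append 0 (d (Fin.last n)) ∈
      outside (extend (purePowers (Fin.init d))) (d (Fin.last n)) :=
    ⟨by simp [degree_append], by rwa [append_mem_extend]⟩
  rw [← Set.ncard_sdiff_singleton_add_one hmem (finite_outside _ _)]
  congr 2
  ext a
  have hdeg := degree_eq_dropLast_add a
  rw [purePowers_succ]
  constructor
  · rintro ⟨h1, h2⟩
    refine ⟨⟨h1, fun h => h2 (Or.inl h)⟩, ?_⟩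
    rintro rfl
    exact h2 (Or.inr (by simp))
  · rintro ⟨⟨h1, h2⟩, h3⟩
    refine ⟨h1, ?_⟩
    rintro (h | h)
    · exact h2 h
    · have h' : d (Fin.last n) ≤ a (Fin.last n) := h
      have h4 : dropLast a = 0 := (Finsupp.degree_eq_zero_iff _).1 (by omega)
      have h5 : a (Fin.last n) = d (Fin.last n) := by omega
      exact h3 (by rw [Set.mem_singleton_iff, ← h5, ← h4, append_dropLast])

lemma outside_purePowers_eq_empty (d : Fin n → ℕ) {t : ℕ} (ht : ∑ i, d i < t + n) :
    outside (purePowers d) t = ∅ := by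
  refine Set.eq_empty_iff_forall_notMem.2 ?_
  rintro a ⟨h1, h2⟩
  have h3 : ∀ i, a i + 1 ≤ d i := by
    intro i
    by_contra hc
    exact h2 ⟨i, by omega⟩
  have h4 := Finset.sum_le_sum fun i (_ : i ∈ Finset.univ) => h3 i
  rw [Finset.sum_add_distrib, ← Finsupp.degree_eq_sum] at h4
  simp at h4
  omega

end Extend

/-! ### Monomial ideals and their sets of terms -/

section Monomial

variable {K : Type*} [Field K] {n : ℕ}

/-- The exponents of the terms in an ideal. -/
def exponents (J : Ideal (MvPolynomial (Fin n) K)) : Set (Fin n →₀ ℕ) :=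
  {a | term K a ∈ J}

lemma mem_span_term {S : Set (Fin n →₀ ℕ)} {p : MvPolynomial (Fin n) K} :
    p ∈ Ideal.span (term K '' S) ↔ ∀ a ∈ p.support, ∃ b ∈ S, b ≤ a :=
  mem_ideal_span_monomial_image

lemma exponents_span (S : Set (Fin n →₀ ℕ)) :
    exponents (Ideal.span (term K '' S)) = {a | ∃ b ∈ S, b ≤ a} := by
  classical
  ext a
  change term K a ∈ Ideal.span (term K '' S) ↔ _
  rw [mem_span_term, term, support_monomial, if_neg one_ne_zero]
  simp

lemma isUpperSet_exponents (J : Ideal (MvPolynomial (Fin n) K)) : IsUpperSet (exponents J) := by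
  intro a b hab ha
  obtain ⟨c, rfl⟩ := exists_add_of_le hab
  change term K (a + c) ∈ J
  rw [show term K (a + c) = term K c * term K a by simp [term, monomial_mul, add_comm]]
  exact J.mul_mem_left _ ha

lemma IsMonomialIdeal.eq_span {J : Ideal (MvPolynomial (Fin n) K)} (hJ : IsMonomialIdeal J) :
    J = Ideal.span (term K '' exponents J) := by
  obtain ⟨S, rfl⟩ := hJ
  refine le_antisymm (Ideal.span_mono (Set.image_mono fun a ha => ?_)) (Ideal.span_le.2 ?_)
  · exact Ideal.subset_span ⟨a, ha, rfl⟩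
  · rintro _ ⟨a, ha, rfl⟩
    exact ha

lemma IsMonomialIdeal.mem_iff {J : Ideal (MvPolynomial (Fin n) K)} (hJ : IsMonomialIdeal J)
    {p : MvPolynomial (Fin n) K} : p ∈ J ↔ ∀ a ∈ p.support, a ∈ exponents J := by
  conv_lhs => rw [hJ.eq_span]
  rw [mem_span_term]
  exact forall₂_congr fun a _ =>
    ⟨fun ⟨b, hb, hba⟩ => isUpperSet_exponents J hba hb, fun h => ⟨a, h, le_rfl⟩⟩

lemma isAlmostRevlex_iff {J : Ideal (MvPolynomial (Fin n) K)} :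
    IsAlmostRevlex J ↔ IsMonomialIdeal J ∧ IsAlmostRevlexSet (exponents J) := by
  refine and_congr_right fun _ => ⟨fun h => ⟨isUpperSet_exponents J, ?_⟩, fun h => ?_⟩
  · exact fun a ha hmin => h a ⟨ha, hmin⟩
  · exact fun a ha => h.2 a ha.1 ha.2

lemma sousEscalier_eq (J : Ideal (MvPolynomial (Fin n) K)) (t : ℕ) :
    sousEscalier J t = outside (exponents J) t := rfl

lemma firstExpansion_eq (J : Ideal (MvPolynomial (Fin n) K)) (t : ℕ) :
    firstExpansion J t = expansion (exponents J) (t + 1) := by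
  ext a
  refine and_congr_right fun ha => ⟨fun h b hb hbJ => ?_, fun h => ?_⟩
  · obtain ⟨c, hbc, hca, hc⟩ := exists_between_degree (s := t) hb.le
      (by have := degree_lt_of_lt hb; omega) (by omega)
    obtain ⟨i, hi⟩ := exists_add_single_le (lt_of_le_of_ne hca (by rintro rfl; omega))
    refine h ⟨i, c, hc, isUpperSet_exponents J hbc hbJ, ?_⟩
    by_contra hne
    have := degree_lt_of_lt (lt_of_le_of_ne hi (Ne.symm hne))
    rw [degree_add_single] at this
    omega
  · rintro ⟨i, b, -, hbJ, rfl⟩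
    exact h b (lt_add_of_pos_right b (by simp [pos_iff_ne_zero])) hbJ

/-- The Hilbert function of a monomial ideal counts the terms outside the ideal: their classes form
a basis of the quotient. -/
lemma IsMonomialIdeal.hilbertFunction_eq {J : Ideal (MvPolynomial (Fin n) K)}
    (hJ : IsMonomialIdeal J) (t : ℕ) :
    hilbertFunction J t = (outside (exponents J) t).ncard := by
  classical
  have hfin := finite_outside (exponents J) t
  have : Fintype (outside (exponents J) t) := hfin.fintype
  let v : outside (exponents J) t → MvPolynomial (Fin n) K ⧸ J :=
    fun a => (Ideal.Quotient.mkₐ K J).toLinearMap (term K a.1)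
  have hspan : (homogeneousSubmodule (Fin n) K t).map (Ideal.Quotient.mkₐ K J).toLinearMap =
      Submodule.span K (Set.range v) := by
    apply le_antisymm
    · rintro _ ⟨p, hp, rfl⟩
      rw [p.as_sum, map_sum]
      refine Submodule.sum_mem _ fun a ha => ?_
      rw [show monomial a (coeff a p) = coeff a p • term K a by simp [term, smul_monomial],
        map_smul]
      refine Submodule.smul_mem _ _ ?_
      by_cases haJ : a ∈ exponents J
      · have : (Ideal.Quotient.mkₐ K J).toLinearMap (term K a) = 0 :=
          Ideal.Quotient.eq_zero_iff_mem.2 haJ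
        rw [this]
        exact Submodule.zero_mem _
      · refine Submodule.subset_span ⟨⟨a, ?_, haJ⟩, rfl⟩
        rw [Finsupp.degree_eq_weight_one]
        exact hp (mem_support_iff.1 ha)
    · rw [Submodule.span_le]
      rintro _ ⟨a, rfl⟩
      exact ⟨_, isHomogeneous_monomial _ a.2.1, rfl⟩
  have hli : LinearIndependent K v := by
    rw [Fintype.linearIndependent_iff]
    intro g hg a
    by_contra hne
    have hmem : ∑ b, g b • term K b.1 ∈ J := by
      rw [← Ideal.Quotient.eq_zero_iff_mem]
      have : (Ideal.Quotient.mkₐ K J).toLinearMap (∑ b, g b • term K b.1) = 0 := by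
        rw [map_sum, ← hg]
        exact Finset.sum_congr rfl fun b _ => map_smul _ _ _
      exact this
    refine a.2.2 (hJ.mem_iff.1 hmem a.1 (mem_support_iff.2 ?_))
    rw [coeff_sum, Finset.sum_eq_single a]
    · simpa [term] using hne
    · intro b _ hb
      simp [term, coeff_monomial, Subtype.ext_iff.not.1 hb]
    · simp
  rw [hilbertFunction, hspan, finrank_span_eq_card hli, Set.ncard_eq_toFinset_card' (outside _ _),
    Set.toFinset_card]

lemma isMonomialIdeal_span (S : Set (Fin n →₀ ℕ)) : IsMonomialIdeal (Ideal.span (term K '' S)) :=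
  ⟨S, rfl⟩

lemma IsMonomialIdeal.sup_span {J : Ideal (MvPolynomial (Fin n) K)} (hJ : IsMonomialIdeal J)
    (S : Set (Fin n →₀ ℕ)) :
    J ⊔ Ideal.span (term K '' S) = Ideal.span (term K '' (exponents J ∪ S)) := by
  conv_lhs => rw [hJ.eq_span]
  rw [Set.image_union, Ideal.span_union]

lemma IsMonomialIdeal.exponents_sup_span {J : Ideal (MvPolynomial (Fin n) K)}
    (hJ : IsMonomialIdeal J) (S : Set (Fin n →₀ ℕ)) :
    exponents (J ⊔ Ideal.span (term K '' S)) = exponents J ∪ {a | ∃ b ∈ S, b ≤ a} := by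
  rw [hJ.sup_span, exponents_span]
  ext a
  constructor
  · rintro ⟨b, hb | hb, hba⟩
    · exact Or.inl (isUpperSet_exponents J hba hb)
    · exact Or.inr ⟨b, hb, hba⟩
  · rintro (ha | ⟨b, hb, hba⟩)
    · exact ⟨a, Or.inl ha, le_rfl⟩
    · exact ⟨b, Or.inr hb, hba⟩

lemma IsMonomialIdeal.truncation_eq {J : Ideal (MvPolynomial (Fin n) K)}
    (hJ : IsMonomialIdeal J) (e : ℕ) :
    truncation J e = Ideal.span (term K '' {a | a ∈ exponents J ∧ a.degree ≤ e}) := by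
  refine le_antisymm (Ideal.span_le.2 ?_) (Ideal.span_mono ?_)
  · rintro p ⟨hp, s, hs, hps⟩
    refine mem_span_term.2 fun a ha => ⟨a, ⟨hJ.mem_iff.1 hp a ha, ?_⟩, le_rfl⟩
    rw [Finsupp.degree_eq_weight_one]
    exact (hps (mem_support_iff.1 ha)).trans_le hs
  · rintro _ ⟨a, ⟨ha, hae⟩, rfl⟩
    exact ⟨ha, _, hae, isHomogeneous_monomial _ rfl⟩

lemma IsMonomialIdeal.map_truncation_eq {J : Ideal (MvPolynomial (Fin n) K)}
    (hJ : IsMonomialIdeal J) (e : ℕ) :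
    (truncation J e).map (rename Fin.castSucc : MvPolynomial (Fin n) K →ₐ[K] _) =
      Ideal.span (term K '' ((fun a => append a 0) '' {a | a ∈ exponents J ∧ a.degree ≤ e})) := by
  rw [hJ.truncation_eq, Ideal.map_span, Set.image_image, Set.image_image]
  congr 1
  refine Set.image_congr fun a _ => ?_
  simp [term, append, rename_monomial]

lemma IsMonomialIdeal.exponents_map_truncation {J : Ideal (MvPolynomial (Fin n) K)}
    (hJ : IsMonomialIdeal J) (e : ℕ) :
    exponents ((truncation J e).map
      (rename Fin.castSucc : MvPolynomial (Fin n) K →ₐ[K] MvPolynomial (Fin (n + 1)) K)) =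
      extend (truncate (exponents J) e) := by
  rw [hJ.map_truncation_eq, exponents_span]
  ext a
  constructor
  · rintro ⟨_, ⟨b, ⟨hb, hbe⟩, rfl⟩, hba⟩
    exact ⟨b, hb, append_zero_le_iff.1 hba, hbe⟩
  · rintro ⟨b, hb, hba, hbe⟩
    exact ⟨_, ⟨b, ⟨hb, hbe⟩, rfl⟩, append_zero_le_iff.2 hba⟩

lemma pow_X_eq_term (d : Fin n → ℕ) (i : Fin n) :
    (X i : MvPolynomial (Fin n) K) ^ d i = term K (Finsupp.single i (d i)) :=
  X_pow_eq_monomial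

lemma span_pow_X_eq (d : Fin n → ℕ) :
    Ideal.span (Set.range fun i => (X i : MvPolynomial (Fin n) K) ^ d i) =
      Ideal.span (term K '' Set.range fun i => Finsupp.single i (d i)) := by
  simp only [pow_X_eq_term]
  rw [← Set.range_comp]
  rfl

lemma ciHilbertFunction_eq (d : Fin n → ℕ) (t : ℕ) :
    ciHilbertFunction K d t = (outside (purePowers d) t).ncard := by
  rw [ciHilbertFunction, span_pow_X_eq, (isMonomialIdeal_span _).hilbertFunction_eq,
    exponents_span]
  congr 2
  ext a
  simp [purePowers]

end Monomial

/-! ### Hilbert functions of regular sequences -/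

section Regular

variable {K : Type*} [Field K] {n : ℕ}

lemma homogeneousComponent_mul_of_isHomogeneous {d : ℕ} {f : MvPolynomial (Fin n) K}
    (hf : f.IsHomogeneous d) (q : MvPolynomial (Fin n) K) (t : ℕ) :
    homogeneousComponent t (f * q) =
      if t < d then 0 else f * homogeneousComponent (t - d) q := by
  have h1 : ∀ i, homogeneousComponent t (f * homogeneousComponent i q) =
      if t = d + i then f * homogeneousComponent i q else 0 := fun i =>
    homogeneousComponent_of_mem (hf.mul (homogeneousComponent_isHomogeneous i q))
  conv_lhs => rw [← sum_homogeneousComponent q, Finset.mul_sum, map_sum]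
  simp only [h1]
  split_ifs with h
  · exact Finset.sum_eq_zero fun i _ => if_neg (by omega)
  · have h2 : ∀ i, t = d + i ↔ i = t - d := fun i => by omega
    simp only [h2, Finset.sum_ite_eq', Finset.mem_range]
    split_ifs with h3
    · rfl
    · rw [homogeneousComponent_eq_zero _ _ (by omega), mul_zero]

/-- The ideal contains the homogeneous components of its elements. -/
def IsGraded (I : Ideal (MvPolynomial (Fin n) K)) : Prop :=
  ∀ p ∈ I, ∀ t, homogeneousComponent t p ∈ I

lemma isGraded_bot : IsGraded (⊥ : Ideal (MvPolynomial (Fin n) K)) := by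
  intro p hp t
  rw [Ideal.mem_bot.1 hp, map_zero]
  exact zero_mem _

lemma IsGraded.sup_span {I : Ideal (MvPolynomial (Fin n) K)} (hI : IsGraded I) {d : ℕ}
    {f : MvPolynomial (Fin n) K} (hf : f.IsHomogeneous d) : IsGraded (I ⊔ Ideal.span {f}) := by
  intro p hp t
  obtain ⟨g, hg, r, hr, rfl⟩ := Submodule.mem_sup.1 hp
  obtain ⟨q, rfl⟩ := Ideal.mem_span_singleton'.1 hr
  rw [map_add, mul_comm, homogeneousComponent_mul_of_isHomogeneous hf]
  refine add_mem (Ideal.mem_sup_left (hI g hg t)) (Ideal.mem_sup_right ?_)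
  split_ifs
  · exact zero_mem _
  · exact Ideal.mul_mem_right _ _ (Ideal.mem_span_singleton_self f)

/-- The effect on the Hilbert function of adding a form that is regular modulo the ideal, read off
from `0 → (R/I)_{t-d} → (R/I)_t → (R/(I + (f)))_t → 0`. -/
lemma IsGraded.hilbertFunction_sup_span {I : Ideal (MvPolynomial (Fin n) K)}
    (hI : IsGraded I) {d : ℕ}
    {f : MvPolynomial (Fin n) K} (hf : f.IsHomogeneous d) (hreg : ∀ p, f * p ∈ I → p ∈ I) :
    hilbertFunction (I ⊔ Ideal.span {f}) = mulOneSubPow d (hilbertFunction I) := by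
  funext t
  let V : ℕ → Submodule K (MvPolynomial (Fin n) K ⧸ I) := fun s =>
    (homogeneousSubmodule (Fin n) K s).map (Ideal.Quotient.mkₐ K I).toLinearMap
  have hfin : FiniteDimensional K (V t) :=
    Module.Finite.iff_fg.2 ((homogeneousSubmodule_fg (Fin n) K t).map _)
  let π : (MvPolynomial (Fin n) K ⧸ I) →ₗ[K] MvPolynomial (Fin n) K ⧸ (I ⊔ Ideal.span {f}) :=
    (Ideal.Quotient.factorₐ K (le_sup_left : I ≤ I ⊔ Ideal.span {f})).toLinearMap
  let μ : (MvPolynomial (Fin n) K ⧸ I) →ₗ[K] MvPolynomial (Fin n) K ⧸ I :=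
    LinearMap.mulLeft K (Ideal.Quotient.mk I f)
  have hμ : Function.Injective μ := by
    rw [← LinearMap.ker_eq_bot, LinearMap.ker_eq_bot']
    intro x hx
    obtain ⟨p, rfl⟩ := Ideal.Quotient.mk_surjective x
    have : Ideal.Quotient.mk I (f * p) = 0 := by rw [map_mul]; exact hx
    exact Ideal.Quotient.eq_zero_iff_mem.2 (hreg p (Ideal.Quotient.eq_zero_iff_mem.1 this))
  have hrange : LinearMap.range (π.domRestrict (V t)) =
      (homogeneousSubmodule (Fin n) K t).map
        (Ideal.Quotient.mkₐ K (I ⊔ Ideal.span {f})).toLinearMap := by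
    rw [LinearMap.range_domRestrict, ← Submodule.map_comp]
    rfl
  have hker : ((LinearMap.ker (π.domRestrict (V t))).map (V t).subtype) =
      if t < d then ⊥ else (V (t - d)).map μ := by
    apply le_antisymm
    · rintro _ ⟨⟨x, p, hp, rfl⟩, hx, rfl⟩
      have hp' : p.IsHomogeneous t := hp
      have hx' : Ideal.Quotient.mk (I ⊔ Ideal.span {f}) p = 0 := hx
      obtain ⟨g, hg, r, hr, hgr⟩ := Submodule.mem_sup.1 (Ideal.Quotient.eq_zero_iff_mem.1 hx')
      obtain ⟨q, rfl⟩ := Ideal.mem_span_singleton'.1 hr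
      have h1 := congrArg (homogeneousComponent t) hgr
      rw [map_add, mul_comm, homogeneousComponent_mul_of_isHomogeneous hf,
        homogeneousComponent_eq_self hp'] at h1
      change Ideal.Quotient.mk I p ∈ _
      have hg' : Ideal.Quotient.mk I (homogeneousComponent t g) = 0 :=
        Ideal.Quotient.eq_zero_iff_mem.2 (hI g hg t)
      rw [← h1, map_add, hg', zero_add]
      split_ifs
      · rw [map_zero]
        exact zero_mem _
      · rw [map_mul]
        exact ⟨_, ⟨_, homogeneousComponent_isHomogeneous _ q, rfl⟩, rfl⟩
    · split_ifs with h
      · exact bot_le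
      · rintro _ ⟨_, ⟨q, hq, rfl⟩, rfl⟩
        have hfq : (f * q).IsHomogeneous t := by
          have := hf.mul (show q.IsHomogeneous (t - d) from hq)
          rwa [show d + (t - d) = t by omega] at this
        refine ⟨⟨Ideal.Quotient.mk I (f * q), f * q, hfq, rfl⟩, ?_, by simp [μ]⟩
        change Ideal.Quotient.mk (I ⊔ Ideal.span {f}) (f * q) = 0
        exact Ideal.Quotient.eq_zero_iff_mem.2
          (Ideal.mem_sup_right (Ideal.mul_mem_right _ _ (Ideal.mem_span_singleton_self f)))
  have hdim := (π.domRestrict (V t)).finrank_range_add_finrank_ker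
  rw [hrange, (Submodule.equivMapOfInjective (V t).subtype (V t).injective_subtype
    (LinearMap.ker (π.domRestrict (V t)))).finrank_eq, hker] at hdim
  change hilbertFunction _ t + _ = hilbertFunction I t at hdim
  unfold mulOneSubPow
  split_ifs with h
  · rwa [if_pos h, finrank_bot, add_zero] at hdim
  · rw [if_neg h, ← (Submodule.equivMapOfInjective μ hμ (V (t - d))).finrank_eq] at hdim
    change _ + hilbertFunction I (t - d) = _ at hdim
    omega

/-- The sequence obtained from the Hilbert function of the polynomial ring by multiplying its series
by `1 - z^{d_i}` for the first `k` of the `d_i`, with negative values replaced by `0` each time. -/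
def ciSequence (K : Type*) [Field K] {n : ℕ} (d : Fin n → ℕ) (k : ℕ) : ℕ → ℕ :=
  ((List.ofFn d).take k).foldl (fun a e => mulOneSubPow e a)
    (hilbertFunction (⊥ : Ideal (MvPolynomial (Fin n) K)))

lemma ciSequence_succ (d : Fin n → ℕ) {k : ℕ} (hk : k < n) :
    ciSequence K d (k + 1) = mulOneSubPow (d ⟨k, hk⟩) (ciSequence K d k) := by
  have hlen : k < (List.ofFn d).length := by simpa
  rw [ciSequence, ← List.take_append_getElem hlen, List.foldl_append]
  simp [ciSequence]

lemma ofList_take_succ (f : Fin n → MvPolynomial (Fin n) K) {k : ℕ} (hk : k < n) :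
    Ideal.ofList ((List.ofFn f).take (k + 1)) =
      Ideal.ofList ((List.ofFn f).take k) ⊔ Ideal.span {f ⟨k, hk⟩} := by
  have hlen : k < (List.ofFn f).length := by simpa
  rw [← List.take_append_getElem hlen, Ideal.ofList_append, Ideal.ofList_singleton]
  simp

lemma ofList_ofFn (f : Fin n → MvPolynomial (Fin n) K) :
    Ideal.ofList (List.ofFn f) = Ideal.span (Set.range f) := by
  rw [Ideal.ofList]
  congr 1
  ext p
  simp [List.mem_ofFn]

lemma isWeaklyRegular_ofFn_iff (f : Fin n → MvPolynomial (Fin n) K) :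
    RingTheory.Sequence.IsWeaklyRegular (MvPolynomial (Fin n) K) (List.ofFn f) ↔
      ∀ (k : ℕ) (hk : k < n), ∀ p, f ⟨k, hk⟩ * p ∈ Ideal.ofList ((List.ofFn f).take k) →
        p ∈ Ideal.ofList ((List.ofFn f).take k) := by
  rw [RingTheory.Sequence.isWeaklyRegular_iff]
  simp only [List.length_ofFn, isSMulRegular_quotient_iff_mem_of_smul_mem, smul_eq_mul,
    Ideal.mul_top, List.getElem_ofFn]

lemma IsCompleteIntersection.hilbertFunction_eq {d : Fin n → ℕ}
    {f : Fin n → MvPolynomial (Fin n) K} (h : IsCompleteIntersection d f) :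
    hilbertFunction (Ideal.span (Set.range f)) = ciSequence K d n := by
  have hreg := (isWeaklyRegular_ofFn_iff f).1 h.2.toIsWeaklyRegular
  have key : ∀ k ≤ n, IsGraded (Ideal.ofList ((List.ofFn f).take k)) ∧
      hilbertFunction (Ideal.ofList ((List.ofFn f).take k)) = ciSequence K d k := by
    intro k
    induction k with
    | zero => exact fun _ => by simpa [ciSequence] using isGraded_bot
    | succ k ih =>
      intro hk
      obtain ⟨h1, h2⟩ := ih (by omega)
      rw [ofList_take_succ f hk, ciSequence_succ d hk, ← h2]
      exact ⟨h1.sup_span (h.1 _), h1.hilbertFunction_sup_span (h.1 _) (hreg k hk)⟩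
  rw [← ofList_ofFn, ← (key n le_rfl).2, List.take_of_length_le (by simp)]

lemma isCompleteIntersection_pow_X {d : Fin n → ℕ} (hd : ∀ i, 0 < d i) :
    IsCompleteIntersection d fun i => (X i : MvPolynomial (Fin n) K) ^ d i := by
  have hspan : ∀ k ≤ n, Ideal.ofList ((List.ofFn fun i =>
      (X i : MvPolynomial (Fin n) K) ^ d i).take k) =
      Ideal.span (term K '' ((fun i => Finsupp.single i (d i)) '' {i : Fin n | (i : ℕ) < k})) := by
    intro k
    induction k with
    | zero => simp
    | succ k ih =>
      intro hk
      rw [ofList_take_succ _ hk, ih (by omega), pow_X_eq_term, ← Set.image_singleton,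
        ← Ideal.span_union, ← Set.image_union]
      congr 2
      rw [← Set.image_singleton (f := fun i => Finsupp.single i (d i)) (a := ⟨k, hk⟩),
        ← Set.image_union]
      congr 1
      ext i
      simp [Fin.ext_iff]
      omega
  refine ⟨fun i => isHomogeneous_X_pow i (d i), ⟨(isWeaklyRegular_ofFn_iff _).2 ?_, ?_⟩⟩
  · intro k hk p hp
    rw [hspan k hk.le, mem_span_term] at hp ⊢
    intro a ha
    obtain ⟨_, ⟨i, hi, rfl⟩, hia⟩ := hp (Finsupp.single ⟨k, hk⟩ (d ⟨k, hk⟩) + a) (by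
      rw [mem_support_iff, pow_X_eq_term, term, coeff_monomial_mul, one_mul]
      exact mem_support_iff.1 ha)
    refine ⟨_, ⟨i, hi, rfl⟩, ?_⟩
    have hne : (⟨k, hk⟩ : Fin n) ≠ i := fun h => by
      have := congrArg Fin.val h
      simp at hi this
      omega
    simpa [Finsupp.single_apply, hne] using hia
  · rw [smul_eq_mul, Ideal.mul_top]
    intro htop
    have h1 : (1 : MvPolynomial (Fin n) K) ∈ Ideal.ofList ((List.ofFn fun i =>
        (X i : MvPolynomial (Fin n) K) ^ d i).take n) := by
      rw [List.take_of_length_le (by simp), ← htop]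
      trivial
    rw [hspan n le_rfl, mem_span_term] at h1
    obtain ⟨_, ⟨i, -, rfl⟩, hi⟩ := h1 0 (by simp)
    have := hi i
    simp at this
    have := hd i
    omega

lemma ciHilbertFunction_eq_ciSequence {d : Fin n → ℕ} (hd : ∀ i, 0 < d i) :
    ciHilbertFunction K d = ciSequence K d n :=
  (isCompleteIntersection_pow_X hd).hilbertFunction_eq

/-- The Hilbert function of a complete intersection is a revlex sequence. -/
lemma isRevlexSequence_ciHilbertFunction {d : Fin n → ℕ} (hd : ∀ i, 0 < d i) :
    IsRevlexSequence n (ciHilbertFunction K d) := by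
  rw [ciHilbertFunction_eq_ciSequence hd]
  suffices h : ∀ k ≤ n, IsRevlexSequence n (ciSequence K d k) from h n le_rfl
  intro k
  induction k with
  | zero =>
    intro _
    -- The Hilbert function of the polynomial ring is that of the empty almost revlex set.
    have hbot : (⊥ : Ideal (MvPolynomial (Fin n) K)) = Ideal.span (term K '' ∅) := by simp
    have h0 : hilbertFunction (⊥ : Ideal (MvPolynomial (Fin n) K)) =
        fun t => (outside (∅ : Set (Fin n →₀ ℕ)) t).ncard := by
      funext t
      rw [hbot, (isMonomialIdeal_span _).hilbertFunction_eq, exponents_span]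
      simp
    have hempty : IsAlmostRevlexSet (∅ : Set (Fin n →₀ ℕ)) :=
      ⟨isUpperSet_empty, fun a ha => absurd ha (Set.notMem_empty a)⟩
    simpa [ciSequence, h0] using hempty.isRevlexSequence
  | succ k ih =>
    intro hk
    rw [ciSequence_succ d hk]
    exact (ih (by omega)).mulOneSubPow (hd _)

end Regular

/-! ### The construction -/

section Construction

variable {K : Type*} [Field K] {n : ℕ}

/-- `J` is an almost revlex ideal generated in degrees at most `t`, with Hilbert function `H` up to
degree `t`. -/
structure RealizesUpTo (H : ℕ → ℕ) (J : Ideal (MvPolynomial (Fin n) K)) (t : ℕ) : Prop where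
  isMonomialIdeal : IsMonomialIdeal J
  isAlmostRevlexSet : IsAlmostRevlexSet (exponents J)
  generated : GeneratedInDegreeLE (exponents J) t
  ncard_outside : ∀ s ≤ t, (outside (exponents J) s).ncard = H s

lemma IsMonomialIdeal.sup {J : Ideal (MvPolynomial (Fin n) K)} (hJ : IsMonomialIdeal J)
    (S : Set (Fin n →₀ ℕ)) : IsMonomialIdeal (J ⊔ Ideal.span (term K '' S)) :=
  hJ.sup_span S ▸ isMonomialIdeal_span _

lemma RealizesUpTo.addHighest {H : ℕ → ℕ} (hH : IsRevlexSequence n H)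
    {J : Ideal (MvPolynomial (Fin n) K)} {t : ℕ} (hJ : RealizesUpTo H J t) :
    RealizesUpTo H (addHighest H J t) (t + 1) := by
  have hexp : exponents (AlmostRevlex.addHighest H J t) = addTop (exponents J) (t + 1)
      ((outside (exponents J) (t + 1)).ncard - H (t + 1)) := by
    rw [AlmostRevlex.addHighest, hJ.isMonomialIdeal.exponents_sup_span, firstExpansion_eq,
      expansion_eq_outside hJ.isAlmostRevlexSet.1 hJ.generated, addTop]
  refine ⟨hJ.isMonomialIdeal.sup _, ?_, ?_, ?_⟩
  · exact hexp ▸ hJ.isAlmostRevlexSet.addTop _ _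
  · exact hexp ▸ (hJ.generated.mono (Nat.le_succ t)).addTop _
  · exact hexp ▸ hJ.isAlmostRevlexSet.ncard_outside_addTop_eq hH hJ.generated hJ.ncard_outside

lemma RealizesUpTo.addHighestIter {H : ℕ → ℕ} (hH : IsRevlexSequence n H)
    {J : Ideal (MvPolynomial (Fin n) K)} {t : ℕ} (hJ : RealizesUpTo H J t) (k : ℕ) :
    RealizesUpTo H (addHighestIter H J t k) (t + k) := by
  induction k with
  | zero => exact hJ
  | succ k ih => exact ih.addHighest hH

/-- The starting ideal has the right Hilbert function: up to degree `d_{n+1}`, the extensions of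
`J` and of the ideal of pure powers of the first `n` variables have the same Hilbert function, and
`x_{n+1}^{d_{n+1}}` removes a single term in degree `d_{n+1}`. -/
lemma realizesUpTo_startingIdeal {d : Fin (n + 1) → ℕ} (hd : ∀ i, 0 < d i)
    {J : Ideal (MvPolynomial (Fin n) K)} (hJ : IsMonomialIdeal J)
    (hJ' : IsAlmostRevlexSet (exponents J))
    (h : ∀ t, (outside (exponents J) t).ncard = (outside (purePowers (Fin.init d)) t).ncard) :
    RealizesUpTo (ciHilbertFunction K d) (startingIdeal J (d (Fin.last n))) (d (Fin.last n)) := by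
  set e := d (Fin.last n) with he
  have hmon : IsMonomialIdeal ((truncation J e).map
      (rename Fin.castSucc : MvPolynomial (Fin n) K →ₐ[K] MvPolynomial (Fin (n + 1)) K)) :=
    hJ.map_truncation_eq e ▸ isMonomialIdeal_span _
  have hexp : exponents (startingIdeal J e) = addTop (extend (truncate (exponents J) e)) e 1 := by
    rw [startingIdeal, hmon.exponents_sup_span, sousEscalier_eq, hJ.exponents_map_truncation,
      addTop]
  have hcount : ∀ s ≤ e, (outside (extend (truncate (exponents J) e)) s).ncard =
      (outside (extend (purePowers (Fin.init d))) s).ncard := by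
    intro s hs
    rw [ncard_outside_extend, ncard_outside_extend]
    refine Finset.sum_congr rfl fun u hu => ?_
    rw [outside_truncate hJ'.1 (by have := Finset.mem_range.1 hu; omega), h]
  refine ⟨hmon.sup _, ?_, ?_, fun s hs => ?_⟩
  · exact hexp ▸ (hJ'.truncate e).extend.addTop _ _
  · exact hexp ▸ (generatedInDegreeLE_truncate _ e).extend.addTop _
  · rw [hexp, ciHilbertFunction_eq]
    rcases hs.lt_or_eq with hs | rfl
    · rw [outside_addTop_of_lt _ hs, outside_purePowers_of_lt d hs, hcount s hs.le]
    · have h1 := ncard_outside_purePowers_last hd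
      have h2 := hcount e le_rfl
      rw [← he] at h1
      rw [ncard_outside_addTop _ (by omega)]
      omega

theorem construction_spec (d : Fin n → ℕ) (hd : ∀ i, 0 < d i) :
    IsMonomialIdeal (construction K n d) ∧
      IsAlmostRevlexSet (exponents (construction K n d)) ∧
      ∀ t, (outside (exponents (construction K n d)) t).ncard = ciHilbertFunction K d t := by
  induction n with
  | zero =>
    have hbot : construction K 0 d = Ideal.span (term K '' ∅) := by simp [construction]
    have hexp : exponents (construction K 0 d) = ∅ := by rw [hbot, exponents_span]; simp
    refine ⟨hbot ▸ isMonomialIdeal_span _, ?_, fun t => ?_⟩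
    · rw [hexp]
      exact ⟨isUpperSet_empty, fun a ha => absurd ha (Set.notMem_empty a)⟩
    · have hpp : purePowers d = ∅ :=
        Set.eq_empty_iff_forall_notMem.2 fun a ⟨i, _⟩ => i.elim0
      rw [hexp, ciHilbertFunction_eq, hpp]
  | succ n ih =>
    obtain ⟨h1, h2, h3⟩ := ih (Fin.init d) fun i => hd i.castSucc
    have hstart := realizesUpTo_startingIdeal hd h1 h2 fun t => by
      rw [h3, ciHilbertFunction_eq]
    have hJ := hstart.addHighestIter (isRevlexSequence_ciHilbertFunction hd)
      ((∑ i, d i) - (n + 1) + 1 - d (Fin.last n))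
    -- The last degree treated is at least `∑ d_i - (n + 1) + 1`, where the Hilbert function
    -- vanishes; there is no truncation in the first subtraction because each `d_i` is positive.
    have hsum : n + 1 ≤ ∑ i, d i := by
      simpa using Finset.sum_le_sum (f := fun _ => 1) (g := d) fun i (_ : i ∈ Finset.univ) => hd i
    set T := d (Fin.last n) + ((∑ i, d i) - (n + 1) + 1 - d (Fin.last n)) with hT
    have hvan : ∀ t, T ≤ t → outside (purePowers d) t = ∅ := fun t ht =>
      outside_purePowers_eq_empty d (by omega)
    refine ⟨hJ.isMonomialIdeal, hJ.isAlmostRevlexSet, fun t => ?_⟩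
    rcases le_total t T with ht | ht
    · exact hJ.ncard_outside t ht
    · have h4 := hJ.ncard_outside T le_rfl
      rw [ciHilbertFunction_eq, hvan T le_rfl, Set.ncard_empty,
        Set.ncard_eq_zero (finite_outside _ _)] at h4
      rw [ciHilbertFunction_eq, hvan t ht]
      exact congrArg Set.ncard (outside_eq_empty_of_le hJ.isAlmostRevlexSet.1 h4 ht)

end Construction

end AlmostRevlex

end

theorem theorem4p1 (K : Type*) [Field K] (n : ℕ) (d : Fin n → ℕ) (hd : Monotone d)
    (hd2 : ∀ i, 2 ≤ d i) :
    AlmostRevlex.IsCompleteIntersection d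
        (fun i => (MvPolynomial.X i : MvPolynomial (Fin n) K) ^ d i) ∧
      ∃ J : Ideal (MvPolynomial (Fin n) K),
        AlmostRevlex.IsAlmostRevlex J ∧
        (∀ f : Fin n → MvPolynomial (Fin n) K, AlmostRevlex.IsCompleteIntersection d f →
          ∀ t : ℕ, AlmostRevlex.hilbertFunction J t =
            AlmostRevlex.hilbertFunction (Ideal.span (Set.range f)) t) ∧
        (∀ J' : Ideal (MvPolynomial (Fin n) K), AlmostRevlex.IsAlmostRevlex J' →
          (∀ t : ℕ, AlmostRevlex.hilbertFunction J' t = AlmostRevlex.hilbertFunction J t) →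
          J' = J) ∧
        J = AlmostRevlex.construction K n d := by
  have hpos : ∀ i, 0 < d i := fun i => by have := hd2 i; omega
  obtain ⟨h1, h2, h3⟩ := AlmostRevlex.construction_spec (K := K) d hpos
  refine ⟨AlmostRevlex.isCompleteIntersection_pow_X hpos, AlmostRevlex.construction K n d,
    AlmostRevlex.isAlmostRevlex_iff.2 ⟨h1, h2⟩, fun f hf t => ?_, fun J' hJ' hH => ?_, rfl⟩
  · rw [h1.hilbertFunction_eq, h3, hf.hilbertFunction_eq,
      AlmostRevlex.ciHilbertFunction_eq_ciSequence hpos]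
  · obtain ⟨h1', h2'⟩ := AlmostRevlex.isAlmostRevlex_iff.1 hJ'
    have hexp := h2'.eq_of_ncard_outside_eq h2 fun t => by
      rw [← h1'.hilbertFunction_eq, ← h1.hilbertFunction_eq, hH]
    rw [h1'.eq_span, hexp, ← h1.eq_span]
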